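/- Let $\{t_k\}_{k\ge 0}$ be a Poisson point process on $[0,\infty)$ with rate $\lambda>0$. Let $\{a_k\}_{k\ge 0}$ be i.i.d. marks with values in $\{0,1,2,\dots\}$, independent of $\{t_k\}$ and not almost surely $0$, with $g(z)=E[z^{a_1}]$ for $|z|\le 1$. Let $A(t)=\sum_{k:\,t_k\le t}a_k$ be the corresponding marked (compound) Poisson process. Let $0\le\tau_0\le\tau_1\le\cdots$ be a delayed renewal process independent of the process $A$: with $\tau_{-1}=0$, the gaps $\Delta_n=\tau_n-\tau_{n-1}$ $(n\ge 0)$ are nonnegative and independent, and $\Delta_1,\Delta_2,\dots$ are identically distributed and not almost surely $0$. Put $A_n=A(\tau_n)$ for $n\ge0$, $A_{-1}=0$, $X_n=A_n-A_{n-1}$, and, for $|z|\le 1$ and $\operatorname{Re}\vartheta\ge 0$, $$\gamma_0(z,\vartheta)=E\big[z^{X_0}e^{-\vartheta\Delta_0}\big],\qquad \gamma(z,\vartheta)=E\big[z^{X_1}e^{-\vartheta\Delta_1}\big].$$ Let $M\ge 0$ be an integer and $\nu=\inf\{n\ge 0: A_n>M\}$. For $t\ge 0$ and complex $u,v,y$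 of modulus at most $1$ and $w,x$ with nonnegative real part, let $$G_1(t)=E\big[u^{A_{\nu-1}}v^{A_\nu}e^{-w\tau_{\nu-1}-x\Delta_\nu}\,y^{A(t)}\,\mathbf 1_{\{t<\tau_{\nu-1}\}}\big].$$ For $k\ge 0$ and a function $\varphi$ analytic at $0$ let $$\mathcal D_s^k\{\varphi(s)\}=\frac1{k!}\,\frac{d^k}{ds^k}\Big[\frac{\varphi(s)}{1-s}\Big]_{s=0}.$$ Then $\nu<\infty$ almost surely, so that the random variable in the definition of $G_1(t)$ is almost surely defined, and it is integrable for every $t\ge0$. Moreover, for every complex $\theta$ with $\operatorname{Re}\theta>0$, the function $t\mapsto e^{-\theta t}G_1(t)$ is integrable on $[0,\infty)$, the function $s\mapsto B_1(B_2-B_3)$ is analytic at $s=0$, and $$\int_0^\infty e^{-\theta t}G_1(t)\,dt=\mathcal D_s^{M}\big\{B_1(B_2-B_3)\big\},$$ where $$B_1=\frac{\gamma(v,x)-\gamma(vs,x)}{\theta+\lambda g(uvs)-\lambda g(uvys)},\qquad B_2=\frac{\gamma_0(uvs,w)}{1-\gamma(uvs,w)},\qquad B_3=\frac{\gamma_0(uvys,\theta+w)}{1-\gamma(uvys,\theta+w)}.$$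 (Replacing $M\ge1$ by $M-1$, the operator $\mathcal D_s^{M-1}$ gives the same transform for the exit index $\inf\{n: A_n\ge M\}$.) -/

import Mathlib

open MeasureTheory ProbabilityTheory

/-- The random counting measure `∑ₖ ε_{tₖ(ω)}` attached to a sequence of random points. -/
noncomputable def countingMeasure {Ω : Type*} (t : ℕ → Ω → ℝ) (ω : Ω) : Measure ℝ :=
  Measure.sum fun k => Measure.dirac (t k ω)

/-- The random points `tₖ` form a Poisson point process on `[0, ∞)` of (constant) rate `lam`:
the counting measure `∑ₖ ε_{tₖ}` is a Poisson random measure with intensity measure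
`lam` times Lebesgue measure on `[0, ∞)`. -/
structure IsPoissonPoints {Ω : Type*} [MeasurableSpace Ω] (P : Measure Ω) (lam : ℝ)
    (t : ℕ → Ω → ℝ) : Prop where
  measurable : ∀ k, Measurable (t k)
  law_count : ∀ B : Set ℝ, MeasurableSet B → volume (B ∩ Set.Ici 0) ≠ ⊤ →
    P.map (fun ω => countingMeasure t ω B) =
      (poissonMeasure (Real.toNNReal (lam * (volume (B ∩ Set.Ici 0)).toReal))).map
        (Nat.cast : ℕ → ENNReal)
  indep_count : ∀ (n : ℕ) (B : Fin n → Set ℝ), (∀ i, MeasurableSet (B i)) →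
    Pairwise (fun i j => Disjoint (B i) (B j)) →
    iIndepFun (fun i ω => countingMeasure t ω (B i)) P

/-- The marked process `A(s) = ∑ₖ aₖ ε_{tₖ}[0, s]`. -/
noncomputable def markedProcess {Ω : Type*} (t : ℕ → Ω → ℝ) (a : ℕ → Ω → ℕ) (s : ℝ) (ω : Ω) : ℕ :=
  ∑' k, (Set.Icc 0 s).indicator (fun _ => a k ω) (t k ω)

/-- The points `tₖ` with marks `aₖ` form a marked Poisson process of rate `lam` with
position-independent marking: the marks are i.i.d. and independent of the points. -/
structure IsMarkedPoisson {Ω : Type*} [MeasurableSpace Ω] (P : Measure Ω) (lam : ℝ)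
    (t : ℕ → Ω → ℝ) (a : ℕ → Ω → ℕ) : Prop where
  points : IsPoissonPoints P lam t
  measurable_mark : ∀ k, Measurable (a k)
  indep_mark : iIndepFun a P
  identDistrib_mark : ∀ k, IdentDistrib (a k) (a 1) P P
  indep_points_marks : IndepFun (fun ω k => t k ω) (fun ω k => a k ω) P

/-- The preceding value `fₙ₋₁` of a sequence of random variables, with `f₋₁ = 0`. -/
def prevValue {Ω R : Type*} [Zero R] (f : ℕ → Ω → R) : ℕ → Ω → R
  | 0 => fun _ => 0
  | n + 1 => f n

/-- The inter-observation times `Δₙ = τₙ - τₙ₋₁`, where `τ₋₁ = 0`. -/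
def gap {Ω : Type*} (τ : ℕ → Ω → ℝ) (n : ℕ) (ω : Ω) : ℝ := τ n ω - prevValue τ n ω

/-- `τ₀ ≤ τ₁ ≤ ⋯` is a delayed renewal process: the gaps `Δ₀, Δ₁, …` are nonnegative and
independent, and `Δ₁, Δ₂, …` are identically distributed. -/
structure IsDelayedRenewal {Ω : Type*} [MeasurableSpace Ω] (P : Measure Ω)
    (τ : ℕ → Ω → ℝ) : Prop where
  measurable : ∀ n, Measurable (τ n)
  gap_nonneg : ∀ n ω, 0 ≤ gap τ n ω
  indep_gap : iIndepFun (gap τ) P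
  identDistrib_gap : ∀ n, IdentDistrib (gap τ (n + 1)) (gap τ 1) P P

/-- The observed values `Aₙ = A(τₙ)`. -/
def observed {Ω : Type*} (A : ℝ → Ω → ℕ) (τ : ℕ → Ω → ℝ) (n : ℕ) (ω : Ω) : ℕ := A (τ n ω) ω

/-- The observed increments `Xₙ = Aₙ - Aₙ₋₁`, where `A₋₁ = 0`. (A marked process is
nondecreasing almost surely, so that the subtraction does not truncate.) -/
def obsIncrement {Ω : Type*} (A : ℝ → Ω → ℕ) (τ : ℕ → Ω → ℝ) (n : ℕ) (ω : Ω) : ℕ :=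
  observed A τ n ω - prevValue (observed A τ) n ω

/-- The exit index `ν = inf {n : Aₙ > M}`. -/
noncomputable def exitIndex {Ω : Type*} (A : ℝ → Ω → ℕ) (τ : ℕ → Ω → ℝ) (M : ℕ) (ω : Ω) : ℕ :=
  sInf {n | M < observed A τ n ω}

/-- The probability generating function `g(z) = E[z^{a}]`. -/
noncomputable def pgf {Ω : Type*} [MeasurableSpace Ω] (P : Measure Ω) (a : Ω → ℕ) (z : ℂ) : ℂ :=
  ∫ ω, z ^ a ω ∂P

/-- The joint transform `E[z^{Xₙ} e^{-θ Δₙ}]` of the `n`-th observed increment and the `n`-th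
inter-observation time; it is `γ₀` for `n = 0` and `γ` for `n = 1`. -/
noncomputable def jointTransform {Ω : Type*} [MeasurableSpace Ω] (P : Measure Ω)
    (A : ℝ → Ω → ℕ) (τ : ℕ → Ω → ℝ) (n : ℕ) (z θ : ℂ) : ℂ :=
  ∫ ω, z ^ obsIncrement A τ n ω * Complex.exp (-θ * (gap τ n ω : ℂ)) ∂P

/-- The random variable
`u^{A_{ν-1}} v^{A_ν} e^{-w τ_{ν-1} - x Δ_ν} y^{A(t)} 1{t < τ_{ν-1}}`, with `ν` the exit index
for the threshold `M`. -/
noncomputable def preExitVariable {Ω : Type*} (A : ℝ → Ω → ℕ) (τ : ℕ → Ω → ℝ) (M : ℕ)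
    (u v w x y : ℂ) (t : ℝ) (ω : Ω) : ℂ :=
  {ω' | t < prevValue τ (exitIndex A τ M ω') ω'}.indicator
    (fun ω' =>
      u ^ prevValue (observed A τ) (exitIndex A τ M ω') ω' *
      v ^ observed A τ (exitIndex A τ M ω') ω' *
      Complex.exp (-w * ((prevValue τ (exitIndex A τ M ω') ω' : ℝ) : ℂ)
        - x * ((gap τ (exitIndex A τ M ω') ω' : ℝ) : ℂ)) *
      y ^ A t ω') ω

/-- The functional `G₁(t, u, v, w, x, y)`, the expectation of `preExitVariable`. -/
noncomputable def preExitFunctional {Ω : Type*} [MeasurableSpace Ω] (P : Measure Ω)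
    (A : ℝ → Ω → ℕ) (τ : ℕ → Ω → ℝ) (M : ℕ) (u v w x y : ℂ) (t : ℝ) : ℂ :=
  ∫ ω, preExitVariable A τ M u v w x y t ω ∂P

/-- The Laplace transform `∫_{t ≥ 0} e^{-θ t} f(t) dt`. -/
noncomputable def laplaceTransform (f : ℝ → ℂ) (θ : ℂ) : ℂ :=
  ∫ t in Set.Ici (0 : ℝ), Complex.exp (-θ * (t : ℂ)) * f t

/-- The operator `𝓓_s^k φ`: the `k`-th derivative of `φ(s) / (1 - s)` at `s = 0`, divided by `k!`,
for a function `φ` that is analytic at `0`. -/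
noncomputable def invD (k : ℕ) (φ : ℂ → ℂ) : ℂ :=
  (1 / (k.factorial : ℂ)) * iteratedDeriv k (fun s => 1 / (1 - s) * φ s) 0

/-- `B₁ = (γ(v, x) - γ(vs, x)) / (θ + λ g(uvs) - λ g(uvys))`. -/
noncomputable def coeffB1 (g : ℂ → ℂ) (γ : ℂ → ℂ → ℂ) (lam : ℝ) (θ u v x y s : ℂ) : ℂ :=
  (γ v x - γ (v * s) x) / (θ + lam * g (u * v * s) - lam * g (u * v * y * s))

/-- `B₂ = γ₀(uvs, w) / (1 - γ(uvs, w))`. -/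
noncomputable def coeffB2 (γ₀ γ : ℂ → ℂ → ℂ) (u v w s : ℂ) : ℂ :=
  γ₀ (u * v * s) w / (1 - γ (u * v * s) w)

/-- `B₃ = γ₀(uvys, θ + w) / (1 - γ(uvys, θ + w))`. -/
noncomputable def coeffB3 (γ₀ γ : ℂ → ℂ → ℂ) (θ u v w y s : ℂ) : ℂ :=
  γ₀ (u * v * y * s) (θ + w) / (1 - γ (u * v * y * s) (θ + w))

/-! The exit index is removed by a generating function in the threshold. Along a path, `n` is the
last index before exit exactly for the thresholds `m` with `Aₙ ≤ m < Aₙ₊₁`. Summing `s^m` over this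
block gives `(s^{Aₙ} - s^{Aₙ₊₁}) / (1 - s)`, so a sum over thresholds of pre-exit variables becomes
a sum over `n` of terms without exit index (`hasSum_mul_pow_sub_pow`, `hasSum_observedTerm_sub`).
Exit at index 0 contributes nothing, as `t < τ₋₁ = 0` is impossible.

In the `n`-th term the marked process enters through its increments over `[0, t]`, `(t, τₙ]`, `(τₙ,
τₙ₊₁]`, with bases `uvys`, `uvs`, and `v` or `vs`. Given `τ`, these increments are independent, and
an increment over length `ℓ` has generating function `e^{-β(z) ℓ}` with `β(z) = λ(1 - g(z))`
(`IsMarkedPoisson.integral_random_times`). Integrating `e^{-θt}` over `[0, τₙ)` produces the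
denominator of `B₁` and a difference of two exponentials in `τₙ` (`integral_exp_mul_observedTerm`).
Independence of the gaps makes each of them geometric in `n`, and the two geometric series are `B₂`
and `B₃`.

Hence `Φ(s) / (1 - s)`, with `Φ = B₁(B₂ - B₃)`, is near 0 the power series whose coefficients are
the Laplace transforms for the successive thresholds (`hasSum_laplaceTransform`), and `invD M` reads
off the `M`-th one. The interchanges rest on `∑ E|s|^{Aₙ} < ∞` (`summable_integral_pow_observed`),
which also forces almost sure exit. -/

theorem tsum_nat_eq_floor_tsum_ennreal (f : ℕ → ℕ) :
    ∑' k, f k = ⌊(∑' k, (f k : ENNReal)).toReal⌋₊ := by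
  by_cases h : (Function.support f).Finite
  · have h1 : ∑' k, f k = ∑ k ∈ h.toFinset, f k := tsum_eq_sum (by simp)
    have h2 : ∑' k, (f k : ENNReal) = ∑ k ∈ h.toFinset, (f k : ENNReal) := tsum_eq_sum (by simp)
    rw [h1, h2, ← Nat.cast_sum, ENNReal.toReal_natCast, Nat.floor_natCast]
  · have h1 : ¬ Summable f := by
      intro hs
      apply h
      have := (hs.map (Nat.castAddMonoidHom ℤ)
        continuous_of_discreteTopology).hasFiniteSupport_of_discreteTopology
      exact this.subset fun k hk => by simpa using hk
    have h2 : ∑' k, (f k : ENNReal) = ⊤ := by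
      by_contra hne
      have := ENNReal.finite_const_le_of_tsum_ne_top hne one_ne_zero
      refine h (this.subset fun k hk => ?_)
      have : 1 ≤ f k := Nat.one_le_iff_ne_zero.2 hk
      simpa using this
    -- The default values agree: a divergent sum in `ℕ` is 0, and so is `⊤.toReal`.
    rw [tsum_eq_zero_of_not_summable h1, h2]
    simp

/-! ### Joint measurability of the marked process -/

section Measurability

variable {Ω : Type*} [MeasurableSpace Ω] {t : ℕ → Ω → ℝ} {a : ℕ → Ω → ℕ}

/-- Countable sums in `ENNReal` are measurable without any convergence condition. Joint
measurability in time and outcome permits random times and Fubini in `t`. -/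
theorem measurable_markedProcess_uncurry (ht : ∀ k, Measurable (t k))
    (ha : ∀ k, Measurable (a k)) :
    Measurable fun p : ℝ × Ω => markedProcess t a p.1 p.2 := by
  simp only [markedProcess, tsum_nat_eq_floor_tsum_ennreal]
  refine Nat.measurable_floor.comp (Measurable.ennreal_toReal (Measurable.tsum fun k => ?_))
  have : (fun p : ℝ × Ω => (((Set.Icc 0 p.1).indicator (fun _ => a k p.2) (t k p.2) : ℕ) : ENNReal))
      = {p : ℝ × Ω | 0 ≤ t k p.2 ∧ t k p.2 ≤ p.1}.indicator (fun p => (a k p.2 : ENNReal)) := by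
    ext p
    by_cases h : 0 ≤ t k p.2 ∧ t k p.2 ≤ p.1 <;> simp [Set.indicator, h]
  rw [this]
  have ht' : Measurable fun p : ℝ × Ω => t k p.2 := (ht k).comp measurable_snd
  refine Measurable.indicator ?_ ((measurableSet_le measurable_const ht').inter
    (measurableSet_le ht' measurable_fst))
  exact (measurable_of_countable (Nat.cast : ℕ → ENNReal)).comp ((ha k).comp measurable_snd)

theorem measurable_markedProcess_comp (ht : ∀ k, Measurable (t k))
    (ha : ∀ k, Measurable (a k)) {T : Ω → ℝ} (hT : Measurable T) :
    Measurable fun ω => markedProcess t a (T ω) ω :=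
  (measurable_markedProcess_uncurry ht ha).comp (hT.prodMk measurable_id)

end Measurability

/-! ### Point counts and monotone paths -/

section Counting

variable {Ω : Type*} {t : ℕ → Ω → ℝ}

theorem countingMeasure_apply (ω : Ω) {B : Set ℝ} (hB : MeasurableSet B) :
    countingMeasure t ω B = (({k | t k ω ∈ B}.encard : ℕ∞) : ENNReal) := by
  rw [countingMeasure, Measure.sum_apply _ hB, ← ENNReal.tsum_set_one,
    tsum_subtype {k | t k ω ∈ B} fun _ => (1 : ENNReal)]
  refine tsum_congr fun k => ?_
  rw [Measure.dirac_apply' _ hB]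
  rfl

theorem countingMeasure_eq_card (ω : Ω) {B : Set ℝ} (hB : MeasurableSet B) (K : Finset ℕ)
    (hK : ∀ k, k ∈ K ↔ t k ω ∈ B) : countingMeasure t ω B = (K.card : ENNReal) := by
  have : {k | t k ω ∈ B} = (K : Set ℕ) := by ext k; simp [hK]
  rw [countingMeasure_apply ω hB, this, Set.encard_coe_eq_coe_finsetCard]
  simp

theorem measurable_countingMeasure [MeasurableSpace Ω] (ht : ∀ k, Measurable (t k))
    {B : Set ℝ} (hB : MeasurableSet B) : Measurable fun ω => countingMeasure t ω B := by
  simp only [countingMeasure, Measure.sum_apply _ hB]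
  refine Measurable.tsum fun k => ?_
  simp only [Measure.dirac_apply' _ hB]
  exact (measurable_one.indicator hB).comp (ht k)

theorem volume_inter_Ici_ne_top_of_subset_Icc {B : Set ℝ} {c d : ℝ} (h : B ⊆ Set.Icc c d) :
    volume (B ∩ Set.Ici 0) ≠ ⊤ :=
  measure_ne_top_of_subset (Set.inter_subset_left.trans h) (by simp)

/-- A Poisson law has no mass at `⊤`, and countably many windows `[0, n]` suffice. On this event the
path values are finite sums, so the default value 0 of a divergent sum cannot spoil monotonicity. -/
theorem IsPoissonPoints.ae_finite [MeasurableSpace Ω] {P : Measure Ω} {lam : ℝ}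
    (h : IsPoissonPoints P lam t) :
    ∀ᵐ ω ∂P, ∀ T : ℝ, {k | t k ω ∈ Set.Icc 0 T}.Finite := by
  have key : ∀ n : ℕ, ∀ᵐ ω ∂P, countingMeasure t ω (Set.Icc 0 (n : ℝ)) ≠ ⊤ := by
    intro n
    have hm := measurable_countingMeasure h.measurable (measurableSet_Icc (a := (0 : ℝ)) (b := n))
    have hl := h.law_count (Set.Icc 0 (n : ℝ)) measurableSet_Icc
      (volume_inter_Ici_ne_top_of_subset_Icc subset_rfl)
    have : P.map (fun ω => countingMeasure t ω (Set.Icc 0 (n : ℝ))) {⊤} = 0 := by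
      rw [hl, Measure.map_apply (measurable_of_countable _) (measurableSet_singleton _)]
      have : (Nat.cast : ℕ → ENNReal) ⁻¹' {⊤} = ∅ := by ext; simp
      rw [this, measure_empty]
    rw [Measure.map_apply hm (measurableSet_singleton _)] at this
    rw [ae_iff]
    simpa [Set.preimage] using this
  filter_upwards [ae_all_iff.2 key] with ω hω T
  obtain ⟨n, hn⟩ := exists_nat_ge T
  have := hω n
  rw [countingMeasure_apply ω measurableSet_Icc] at this
  have hfin : {k | t k ω ∈ Set.Icc 0 (n : ℝ)}.Finite := by
    rw [← Set.encard_ne_top_iff]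
    simpa using this
  exact hfin.subset fun k hk => ⟨hk.1, hk.2.trans hn⟩

theorem markedProcess_eq_sum (a : ℕ → Ω → ℕ) (ω : Ω) {S T : ℝ} (hST : S ≤ T) (K : Finset ℕ)
    (hK : ∀ k, k ∈ K ↔ t k ω ∈ Set.Icc 0 T) :
    markedProcess t a S ω = ∑ k ∈ K, if t k ω ≤ S then a k ω else 0 := by
  rw [markedProcess, tsum_eq_sum (s := K)]
  · refine Finset.sum_congr rfl fun k hk => ?_
    have := ((hK k).1 hk).1
    simp [Set.indicator, this]
  · intro k hk
    rw [Set.indicator_of_notMem]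
    intro hk'
    exact hk ((hK k).2 ⟨hk'.1, hk'.2.trans hST⟩)

theorem markedProcess_mono (a : ℕ → Ω → ℕ) {ω : Ω}
    (hω : ∀ T : ℝ, {k | t k ω ∈ Set.Icc 0 T}.Finite) :
    Monotone fun s => markedProcess t a s ω := by
  intro S T hST
  have hK : ∀ k, k ∈ (hω T).toFinset ↔ t k ω ∈ Set.Icc 0 T := by simp
  simp only [markedProcess_eq_sum a ω hST _ hK, markedProcess_eq_sum a ω le_rfl _ hK]
  refine Finset.sum_le_sum fun k _ => ?_
  split_ifs with h1 h2 <;> first | rfl | exact absurd (h1.trans hST) h2 | simp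

end Counting

/-- The right limit at `s` of a nondecreasing path, computed from its values at rational times. -/
noncomputable def rationalRightLimit (p : ℝ → ℕ) (s : ℝ) : ℕ :=
  sInf {c | ∃ q : ℚ, s < q ∧ p q = c}

theorem rationalRightLimit_le_iff (p : ℝ → ℕ) (s : ℝ) (c : ℕ) :
    rationalRightLimit p s ≤ c ↔ ∃ q : ℚ, s < q ∧ p q ≤ c := by
  obtain ⟨q₀, hq₀⟩ := exists_rat_gt s
  have hne : {c | ∃ q : ℚ, s < q ∧ p q = c}.Nonempty := ⟨_, q₀, hq₀, rfl⟩
  constructor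
  · intro h
    obtain ⟨q, hq, hqc⟩ := Nat.sInf_mem hne
    exact ⟨q, hq, hqc.le.trans h⟩
  · rintro ⟨q, hq, hqc⟩
    exact le_trans (Nat.sInf_le (show p q ∈ {c | ∃ q : ℚ, s < q ∧ p q = c} from ⟨q, hq, rfl⟩)) hqc

/-- Evaluation `(p, s) ↦ p s` is not jointly measurable for the product σ-algebra on `ℝ → ℕ`. The
rational right limit involves countably many coordinates only, so it is. -/
theorem measurable_rationalRightLimit_uncurry :
    Measurable fun x : (ℝ → ℕ) × ℝ => rationalRightLimit x.1 x.2 := by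
  refine measurable_of_Iic fun c => ?_
  have : (fun x : (ℝ → ℕ) × ℝ => rationalRightLimit x.1 x.2) ⁻¹' Set.Iic c
      = ⋃ q : ℚ, {x : (ℝ → ℕ) × ℝ | x.2 < (q : ℝ)} ∩ {x | x.1 q ≤ c} := by
    ext x
    simp [rationalRightLimit_le_iff]
  rw [this]
  refine MeasurableSet.iUnion fun q => ?_
  refine (measurableSet_lt measurable_snd measurable_const).inter ?_
  exact measurableSet_le ((measurable_pi_apply (q : ℝ)).comp measurable_fst) measurable_const

/-- This is right continuity: only finitely many points lie in `[0, s + 1]`, so none lies just to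
the right of `s`. -/
theorem rationalRightLimit_markedProcess {Ω : Type*} {t : ℕ → Ω → ℝ} (a : ℕ → Ω → ℕ) {ω : Ω}
    (hω : ∀ T : ℝ, {k | t k ω ∈ Set.Icc 0 T}.Finite) (s : ℝ) :
    rationalRightLimit (fun r => markedProcess t a r ω) s = markedProcess t a s ω := by
  have hK : ∀ k, k ∈ (hω (s + 1)).toFinset ↔ t k ω ∈ Set.Icc 0 (s + 1) := by simp
  refine le_antisymm ?_ ?_
  · rw [rationalRightLimit_le_iff]
    have hev : ∀ᶠ q in nhdsWithin s (Set.Ioi s), ∀ k ∈ (hω (s + 1)).toFinset,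
        t k ω ≤ q → t k ω ≤ s := by
      rw [Filter.eventually_all_finset]
      intro k _
      rcases le_or_gt (t k ω) s with h | h
      · exact Filter.Eventually.of_forall fun _ _ => h
      · filter_upwards [nhdsWithin_le_nhds (Iio_mem_nhds h)] with q hq hq'
        exact absurd hq' (not_le.2 hq)
    rw [Filter.Eventually, mem_nhdsGT_iff_exists_Ioo_subset] at hev
    obtain ⟨r, hr, hsub⟩ := hev
    obtain ⟨q, hq1, hq2⟩ := exists_rat_btwn (lt_min (show s < r from hr) (lt_add_one s))
    refine ⟨q, hq1, ?_⟩
    have hq := hsub ⟨hq1, hq2.trans_le (min_le_left _ _)⟩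
    rw [markedProcess_eq_sum a ω (hq2.le.trans (min_le_right _ _)) _ hK,
      markedProcess_eq_sum a ω (lt_add_one s).le _ hK]
    refine Finset.sum_le_sum fun k hk => ?_
    have := hq k hk
    split_ifs with h1 h2 <;> first | rfl | exact absurd (this h1) h2 | simp
  · obtain ⟨q, hq, h⟩ := (rationalRightLimit_le_iff _ s _).1
      (le_refl (rationalRightLimit (fun r => markedProcess t a r ω) s))
    exact (markedProcess_mono a hω hq.le).trans h

/-! ### Integration over independent variables -/

section Independence

variable {Ω : Type*} [MeasurableSpace Ω] {P : Measure Ω} [IsProbabilityMeasure P]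

theorem integrable_of_norm_le_one {f : Ω → ℂ} (hf : Measurable f) (h : ∀ ω, ‖f ω‖ ≤ 1) :
    Integrable f P :=
  Integrable.of_bound hf.aestronglyMeasurable 1 (Filter.Eventually.of_forall h)

/-- Fubini for the product law. The bound is required only at attained values, because factors such
as `e^{-cr}` are bounded for `r ≥ 0` but not on all of `ℝ`. -/
theorem integral_eq_integral_integral_of_indepFun {E F : Type*} [MeasurableSpace E]
    [MeasurableSpace F] {X : Ω → E} {Y : Ω → F} (hX : Measurable X) (hY : Measurable Y)
    (hXY : IndepFun X Y P) {f : E × F → ℂ} (hf : Measurable f)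
    (hbd : ∀ ω ω', ‖f (X ω, Y ω')‖ ≤ 1) :
    ∫ ω, f (X ω, Y ω) ∂P = ∫ ω, ∫ ω', f (X ω, Y ω') ∂P ∂P := by
  have hmap := (indepFun_iff_map_prod_eq_prod_map_map hX.aemeasurable hY.aemeasurable).1 hXY
  have h1 : ∫ ω, f (X ω, Y ω) ∂P = ∫ p, f p ∂(P.map fun ω => (X ω, Y ω)) :=
    (integral_map (hX.prodMk hY).aemeasurable hf.aestronglyMeasurable).symm
  have hXY' : Measurable (Prod.map X Y) := hX.prodMap hY
  rw [h1, hmap, Measure.map_prod_map _ _ hX hY,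
    integral_map hXY'.aemeasurable hf.aestronglyMeasurable]
  exact integral_prod _ (integrable_of_norm_le_one (hf.comp hXY') fun p => hbd p.1 p.2)

end Independence

theorem iIndepFun.integral_finset_prod_comp {Ω : Type*} [MeasurableSpace Ω] {P : Measure Ω}
    {E : ℕ → Type*} [∀ i, MeasurableSpace (E i)]
    {X : ∀ i, Ω → E i} (hX : iIndepFun X P) (hm : ∀ i, Measurable (X i)) (K : Finset ℕ)
    {f : ∀ i, E i → ℂ} (hf : ∀ i, Measurable (f i)) :
    ∫ ω, ∏ i ∈ K, f i (X i ω) ∂P = ∏ i ∈ K, ∫ ω, f i (X i ω) ∂P := by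
  have h := (hX.precomp (g := fun i : K => (i : ℕ)) Subtype.val_injective).integral_fun_prod_comp
    (f := fun i : K => f i) (fun i => (hm i).aemeasurable)
    (fun i => (hf i).aestronglyMeasurable)
  rw [Finset.prod_coe_sort K (fun i => ∫ ω, f i (X i ω) ∂P)] at h
  rw [← h]
  congr 1
  ext ω
  exact (Finset.prod_coe_sort K (fun i => f i (X i ω))).symm

theorem integral_pow_poissonMeasure (r : NNReal) (z : ℂ) :
    ∫ n, z ^ n ∂(poissonMeasure r) = Complex.exp (-r * (1 - z)) := by
  rw [integral_poissonMeasure]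
  have h := (NormedSpace.expSeries_div_hasSum_exp ((r : ℂ) * z)).mul_left (Complex.exp (-r))
  rw [← Complex.exp_eq_exp_ℂ, ← Complex.exp_add] at h
  convert h.tsum_eq using 1
  · congr 1
    ext n
    rw [mul_pow, Complex.real_smul]
    push_cast
    ring
  · congr 1
    ring

/-! ### Generating functions of increments at fixed times -/

section MarkedPoisson

variable {Ω : Type*} [MeasurableSpace Ω] {P : Measure Ω} {lam : ℝ}
  {t : ℕ → Ω → ℝ} {a : ℕ → Ω → ℕ}

theorem IsPoissonPoints.integral_pow_countingMeasure (h : IsPoissonPoints P lam t)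
    {B : Set ℝ} (hB : MeasurableSet B) (hfin : volume (B ∩ Set.Ici 0) ≠ ⊤) (hlam : 0 ≤ lam)
    (z : ℂ) :
    ∫ ω, z ^ ⌊(countingMeasure t ω B).toReal⌋₊ ∂P
      = Complex.exp (-(lam * (volume (B ∩ Set.Ici 0)).toReal) * (1 - z)) := by
  have hz : Measurable fun c : ENNReal => z ^ ⌊c.toReal⌋₊ :=
    (measurable_of_countable fun n : ℕ => z ^ n).comp
      (Nat.measurable_floor.comp ENNReal.measurable_toReal)
  have h1 := integral_map (μ := P) (f := fun c : ENNReal => z ^ ⌊c.toReal⌋₊)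
    (measurable_countingMeasure h.measurable hB).aemeasurable hz.aestronglyMeasurable
  rw [← h1, h.law_count B hB hfin, integral_map (measurable_of_countable _).aemeasurable
    hz.aestronglyMeasurable]
  simp only [ENNReal.toReal_natCast, Nat.floor_natCast]
  rw [integral_pow_poissonMeasure]
  congr 2
  have : 0 ≤ lam * (volume (B ∩ Set.Ici 0)).toReal := by positivity
  rw [← Complex.ofReal_mul, ← Complex.ofReal_neg, ← Complex.ofReal_neg]
  norm_cast
  rw [Real.coe_toNNReal _ this]

theorem norm_pgf_le_one [IsProbabilityMeasure P] (b : Ω → ℕ) {z : ℂ} (hz : ‖z‖ ≤ 1) :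
    ‖pgf P b z‖ ≤ 1 := by
  have := norm_integral_le_of_norm_le_const (μ := P) (f := fun ω => z ^ b ω) (C := 1)
    (Filter.Eventually.of_forall fun ω => by
      rw [norm_pow]; exact pow_le_one₀ (norm_nonneg _) hz)
  simpa [pgf] using this

theorem measurable_pow_nat (z : ℂ) : Measurable fun n : ℕ => z ^ n := measurable_of_countable _

theorem norm_pow_mul_pow_mul_pow_le_one {z₁ z₂ z₃ : ℂ} (h₁ : ‖z₁‖ ≤ 1) (h₂ : ‖z₂‖ ≤ 1)
    (h₃ : ‖z₃‖ ≤ 1) (i j k : ℕ) : ‖z₁ ^ i * z₂ ^ j * z₃ ^ k‖ ≤ 1 := by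
  simp only [norm_mul, norm_pow]
  exact mul_le_one₀ (mul_le_one₀ (pow_le_one₀ (norm_nonneg _) h₁) (by positivity)
    (pow_le_one₀ (norm_nonneg _) h₂)) (by positivity) (pow_le_one₀ (norm_nonneg _) h₃)

/-- Integrating out the marks: given the points, each point contributes the factor `g(zᵢ)`. -/
theorem IsMarkedPoisson.integral_marks [IsProbabilityMeasure P] (hA : IsMarkedPoisson P lam t a)
    (z₁ z₂ z₃ : ℂ) {T₁ T₂ T₃ : ℝ} (h₁ : 0 ≤ T₁) (h₁₂ : T₁ ≤ T₂) (h₂₃ : T₂ ≤ T₃)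
    {ω : Ω} (hω : ∀ T : ℝ, {k | t k ω ∈ Set.Icc 0 T}.Finite) :
    ∫ ω', z₁ ^ markedProcess (fun k _ => t k ω) a T₁ ω' *
        z₂ ^ (markedProcess (fun k _ => t k ω) a T₂ ω' -
          markedProcess (fun k _ => t k ω) a T₁ ω') *
        z₃ ^ (markedProcess (fun k _ => t k ω) a T₃ ω' -
          markedProcess (fun k _ => t k ω) a T₂ ω') ∂P
      = pgf P (a 1) z₁ ^ ⌊(countingMeasure t ω (Set.Icc 0 T₁)).toReal⌋₊ *
        pgf P (a 1) z₂ ^ ⌊(countingMeasure t ω (Set.Ioc T₁ T₂)).toReal⌋₊ *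
        pgf P (a 1) z₃ ^ ⌊(countingMeasure t ω (Set.Ioc T₂ T₃)).toReal⌋₊ := by
  set K := (hω T₃).toFinset with hKdef
  have hK : ∀ k, k ∈ K ↔ t k ω ∈ Set.Icc 0 T₃ := by simp [hKdef]
  -- The base carried by point `k` depends on the interval containing it, so the integrand is the
  -- product of the `c k ^ a k` over the points in `[0, T₃]`.
  let c : ℕ → ℂ := fun k => if t k ω ≤ T₁ then z₁ else if t k ω ≤ T₂ then z₂ else z₃
  set K₁ := K.filter fun k => t k ω ≤ T₁
  set K₂ := K.filter fun k => ¬ t k ω ≤ T₁ ∧ t k ω ≤ T₂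
  set K₃ := K.filter fun k => ¬ t k ω ≤ T₁ ∧ ¬ t k ω ≤ T₂
  have split : ∀ f : ℕ → ℂ, (∏ k ∈ K, f k) = (∏ k ∈ K₁, f k) * (∏ k ∈ K₂, f k) * ∏ k ∈ K₃, f k := by
    intro f
    rw [← Finset.prod_filter_mul_prod_filter_not K (fun k => t k ω ≤ T₁), mul_assoc,
      ← Finset.prod_filter_mul_prod_filter_not (K.filter fun k => ¬ t k ω ≤ T₁)
        (fun k => t k ω ≤ T₂), Finset.filter_filter, Finset.filter_filter]
  have hc₁ : ∀ k ∈ K₁, c k = z₁ := fun k hk => by simp [c, (Finset.mem_filter.1 hk).2]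
  have hc₂ : ∀ k ∈ K₂, c k = z₂ := fun k hk => by
    have := (Finset.mem_filter.1 hk).2
    simp only [c, if_neg this.1, if_pos this.2]
  have hc₃ : ∀ k ∈ K₃, c k = z₃ := fun k hk => by
    have := (Finset.mem_filter.1 hk).2
    simp only [c, if_neg this.1, if_neg this.2]
  have hN₁ : ⌊(countingMeasure t ω (Set.Icc 0 T₁)).toReal⌋₊ = K₁.card := by
    rw [countingMeasure_eq_card ω measurableSet_Icc K₁]
    · simp
    · intro k
      simp only [K₁, Finset.mem_filter, hK, Set.mem_Icc]
      constructor <;> intro h <;> grind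
  have hN₂ : ⌊(countingMeasure t ω (Set.Ioc T₁ T₂)).toReal⌋₊ = K₂.card := by
    rw [countingMeasure_eq_card ω measurableSet_Ioc K₂]
    · simp
    · intro k
      simp only [K₂, Finset.mem_filter, hK, Set.mem_Icc, Set.mem_Ioc]
      constructor <;> intro h <;> grind
  have hN₃ : ⌊(countingMeasure t ω (Set.Ioc T₂ T₃)).toReal⌋₊ = K₃.card := by
    rw [countingMeasure_eq_card ω measurableSet_Ioc K₃]
    · simp
    · intro k
      simp only [K₃, Finset.mem_filter, hK, Set.mem_Icc, Set.mem_Ioc]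
      constructor <;> intro h <;> grind
  have hsum : ∀ ω', markedProcess (fun k _ => t k ω) a T₁ ω' = ∑ k ∈ K₁, a k ω' ∧
      markedProcess (fun k _ => t k ω) a T₂ ω' = ∑ k ∈ K₁, a k ω' + ∑ k ∈ K₂, a k ω' ∧
      markedProcess (fun k _ => t k ω) a T₃ ω' =
        ∑ k ∈ K₁, a k ω' + ∑ k ∈ K₂, a k ω' + ∑ k ∈ K₃, a k ω' := by
    intro ω'
    have e : ∀ S ≤ T₃, markedProcess (fun k _ => t k ω) a S ω'
        = ∑ k ∈ K, if t k ω ≤ S then a k ω' else 0 := fun S hS =>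
      markedProcess_eq_sum (t := fun k _ => t k ω) a ω' hS K hK
    rw [e T₁ (h₁₂.trans h₂₃), e T₂ h₂₃, e T₃ le_rfl]
    simp only [K₁, K₂, K₃, Finset.sum_filter, ← Finset.sum_add_distrib]
    refine ⟨trivial, Finset.sum_congr rfl fun k hk => ?_, Finset.sum_congr rfl fun k hk => ?_⟩
    · grind
    · have := ((hK k).1 hk).2
      grind
  have hint : ∀ ω', z₁ ^ markedProcess (fun k _ => t k ω) a T₁ ω' *
        z₂ ^ (markedProcess (fun k _ => t k ω) a T₂ ω' -
          markedProcess (fun k _ => t k ω) a T₁ ω') *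
        z₃ ^ (markedProcess (fun k _ => t k ω) a T₃ ω' -
          markedProcess (fun k _ => t k ω) a T₂ ω') = ∏ k ∈ K, c k ^ a k ω' := by
    intro ω'
    obtain ⟨e₁, e₂, e₃⟩ := hsum ω'
    rw [e₁, e₂, e₃, split, Nat.add_sub_cancel_left, Nat.add_sub_cancel_left,
      Finset.prod_congr rfl fun k hk => by rw [hc₁ k hk],
      Finset.prod_congr (s₁ := K₂) rfl fun k hk => by rw [hc₂ k hk],
      Finset.prod_congr (s₁ := K₃) rfl fun k hk => by rw [hc₃ k hk],
      Finset.prod_pow_eq_pow_sum, Finset.prod_pow_eq_pow_sum, Finset.prod_pow_eq_pow_sum]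
  simp only [hint]
  rw [iIndepFun.integral_finset_prod_comp hA.indep_mark hA.measurable_mark K
    (f := fun k n => c k ^ n) (fun k => measurable_pow_nat _)]
  have hg : ∀ k, ∫ ω', c k ^ a k ω' ∂P = pgf P (a 1) (c k) := fun k =>
    ((hA.identDistrib_mark k).comp (measurable_pow_nat (c k))).integral_eq
  simp only [hg]
  rw [split, Finset.prod_congr rfl fun k hk => by rw [hc₁ k hk],
      Finset.prod_congr (s₁ := K₂) rfl fun k hk => by rw [hc₂ k hk],
      Finset.prod_congr (s₁ := K₃) rfl fun k hk => by rw [hc₃ k hk],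
      Finset.prod_const, Finset.prod_const, Finset.prod_const, hN₁, hN₂, hN₃]

/-- The joint generating function of three consecutive increments of a marked Poisson process. -/
theorem IsMarkedPoisson.integral_increments [IsProbabilityMeasure P]
    (hA : IsMarkedPoisson P lam t a) (hlam : 0 ≤ lam) {z₁ z₂ z₃ : ℂ} (hz₁ : ‖z₁‖ ≤ 1)
    (hz₂ : ‖z₂‖ ≤ 1) (hz₃ : ‖z₃‖ ≤ 1) {T₁ T₂ T₃ : ℝ} (h₁ : 0 ≤ T₁) (h₁₂ : T₁ ≤ T₂)
    (h₂₃ : T₂ ≤ T₃) :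
    ∫ ω, z₁ ^ markedProcess t a T₁ ω * z₂ ^ (markedProcess t a T₂ ω - markedProcess t a T₁ ω) *
        z₃ ^ (markedProcess t a T₃ ω - markedProcess t a T₂ ω) ∂P
      = Complex.exp (-(lam * (1 - pgf P (a 1) z₁)) * T₁) *
        Complex.exp (-(lam * (1 - pgf P (a 1) z₂)) * (T₂ - T₁ : ℝ)) *
        Complex.exp (-(lam * (1 - pgf P (a 1) z₃)) * (T₃ - T₂ : ℝ)) := by
  -- The process as a function of the pair (points, marks): independence then allows the points to
  -- be frozen while the marks are integrated.
  let A' : ℝ → (ℕ → ℝ) × (ℕ → ℕ) → ℕ := markedProcess (fun k p => p.1 k) (fun k p => p.2 k)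
  have hA' : ∀ T, Measurable (A' T) := fun T =>
    measurable_markedProcess_comp (fun k => (measurable_pi_apply k).comp measurable_fst)
      (fun k => (measurable_pi_apply k).comp measurable_snd) measurable_const
  have h := integral_eq_integral_integral_of_indepFun (P := P)
    (X := fun ω k => t k ω) (Y := fun ω k => a k ω)
    (measurable_pi_lambda _ hA.points.measurable) (measurable_pi_lambda _ hA.measurable_mark)
    hA.indep_points_marks
    (f := fun p => z₁ ^ A' T₁ p * z₂ ^ (A' T₂ p - A' T₁ p) * z₃ ^ (A' T₃ p - A' T₂ p))
    ((((measurable_pow_nat z₁).comp (hA' T₁)).mul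
      ((measurable_pow_nat z₂).comp ((hA' T₂).sub (hA' T₁)))).mul
      ((measurable_pow_nat z₃).comp ((hA' T₃).sub (hA' T₂))))
    (fun _ _ => norm_pow_mul_pow_mul_pow_le_one hz₁ hz₂ hz₃ _ _ _)
  change ∫ ω, z₁ ^ markedProcess t a T₁ ω *
    z₂ ^ (markedProcess t a T₂ ω - markedProcess t a T₁ ω) *
    z₃ ^ (markedProcess t a T₃ ω - markedProcess t a T₂ ω) ∂P = _ at h
  rw [h]
  let B : Fin 3 → Set ℝ := ![Set.Icc 0 T₁, Set.Ioc T₁ T₂, Set.Ioc T₂ T₃]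
  have hB : ∀ i, MeasurableSet (B i) := by
    intro i; fin_cases i
    exacts [measurableSet_Icc, measurableSet_Ioc, measurableSet_Ioc]
  have hdisj : Pairwise fun i j => Disjoint (B i) (B j) := by
    have d01 : Disjoint (B 0) (B 1) := Set.disjoint_left.2 fun r hr hr' =>
      not_lt.2 (show r ≤ T₁ from hr.2) hr'.1
    have d02 : Disjoint (B 0) (B 2) := Set.disjoint_left.2 fun r hr hr' =>
      not_lt.2 ((show r ≤ T₁ from hr.2).trans h₁₂) hr'.1
    have d12 : Disjoint (B 1) (B 2) := Set.disjoint_left.2 fun r hr hr' =>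
      not_lt.2 (show r ≤ T₂ from hr.2) hr'.1
    intro i j hij
    fin_cases i <;> fin_cases j <;>
      first | exact absurd rfl hij | exact d01 | exact d02 | exact d12 | exact d01.symm
            | exact d02.symm | exact d12.symm
  have hind := (hA.points.indep_count 3 B hB hdisj).integral_fun_prod_comp
    (f := fun i (c : ENNReal) => (![pgf P (a 1) z₁, pgf P (a 1) z₂, pgf P (a 1) z₃] i) ^ ⌊c.toReal⌋₊)
    (fun i => (measurable_countingMeasure hA.points.measurable (hB i)).aemeasurable)
    (fun i => ((measurable_pow_nat _).comp
      (Nat.measurable_floor.comp ENNReal.measurable_toReal)).aestronglyMeasurable)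
  have hpt : ∀ᵐ ω ∂P, (∫ ω', z₁ ^ markedProcess (fun k _ => t k ω) a T₁ ω' *
        z₂ ^ (markedProcess (fun k _ => t k ω) a T₂ ω' -
          markedProcess (fun k _ => t k ω) a T₁ ω') *
        z₃ ^ (markedProcess (fun k _ => t k ω) a T₃ ω' -
          markedProcess (fun k _ => t k ω) a T₂ ω') ∂P)
      = ∏ i, (![pgf P (a 1) z₁, pgf P (a 1) z₂, pgf P (a 1) z₃] i) ^
          ⌊(countingMeasure t ω (B i)).toReal⌋₊ := by
    filter_upwards [hA.points.ae_finite] with ω hω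
    rw [hA.integral_marks z₁ z₂ z₃ h₁ h₁₂ h₂₃ hω, Fin.prod_univ_three]
    rfl
  have hfin : ∀ i, volume (B i ∩ Set.Ici 0) ≠ ⊤ := by
    intro i; fin_cases i
    · exact volume_inter_Ici_ne_top_of_subset_Icc subset_rfl
    · exact volume_inter_Ici_ne_top_of_subset_Icc Set.Ioc_subset_Icc_self
    · exact volume_inter_Ici_ne_top_of_subset_Icc Set.Ioc_subset_Icc_self
  have hvol : ∀ i, (volume (B i ∩ Set.Ici 0)).toReal = (![T₁, T₂ - T₁, T₃ - T₂] : Fin 3 → ℝ) i := by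
    have sub : ∀ i, B i ∩ Set.Ici 0 = B i := by
      intro i
      refine Set.inter_eq_left.2 fun r hr => ?_
      fin_cases i
      · exact (show 0 ≤ r from hr.1)
      · exact h₁.trans (show T₁ < r from hr.1).le
      · exact (h₁.trans h₁₂).trans (show T₂ < r from hr.1).le
    intro i
    rw [sub]
    fin_cases i
    · simp [B, h₁]
    · simp [B, h₁₂]
    · simp [B, h₂₃]
  refine (integral_congr_ae hpt).trans (hind.trans ?_)
  simp only [hA.points.integral_pow_countingMeasure (hB _) (hfin _) hlam, hvol,
    Fin.prod_univ_three]
  simp only [Matrix.cons_val]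
  congr 1
  · congr 1 <;> congr 1 <;> ring
  · congr 1; ring

end MarkedPoisson

/-! ### The marked process at independent random times -/

section Observed

variable {Ω : Type*} [MeasurableSpace Ω] {P : Measure Ω} [IsProbabilityMeasure P] {lam : ℝ}
  {t : ℕ → Ω → ℝ} {a : ℕ → Ω → ℕ} {τ : ℕ → Ω → ℝ}

/-- Integrating out the marked process at random times that depend on `τ` only. -/
theorem IsMarkedPoisson.integral_random_times (hA : IsMarkedPoisson P lam t a) (hlam : 0 ≤ lam)
    (hτ : ∀ n, Measurable (τ n))
    (hindep : IndepFun (fun ω n => τ n ω) (fun ω s => markedProcess t a s ω) P)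
    {z₁ z₂ z₃ : ℂ} (hz₁ : ‖z₁‖ ≤ 1) (hz₂ : ‖z₂‖ ≤ 1) (hz₃ : ‖z₃‖ ≤ 1)
    {ψ : (ℕ → ℝ) → ℂ} (hψ : Measurable ψ) (hψ1 : ∀ ω, ‖ψ fun n => τ n ω‖ ≤ 1)
    {T₁ T₂ T₃ : (ℕ → ℝ) → ℝ} (hT₁ : Measurable T₁) (hT₂ : Measurable T₂) (hT₃ : Measurable T₃)
    (h₁ : ∀ ω, 0 ≤ T₁ fun n => τ n ω) (h₁₂ : ∀ ω, (T₁ fun n => τ n ω) ≤ T₂ fun n => τ n ω)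
    (h₂₃ : ∀ ω, (T₂ fun n => τ n ω) ≤ T₃ fun n => τ n ω) :
    ∫ ω, ψ (fun n => τ n ω) * (z₁ ^ markedProcess t a (T₁ fun n => τ n ω) ω *
        z₂ ^ (markedProcess t a (T₂ fun n => τ n ω) ω -
          markedProcess t a (T₁ fun n => τ n ω) ω) *
        z₃ ^ (markedProcess t a (T₃ fun n => τ n ω) ω -
          markedProcess t a (T₂ fun n => τ n ω) ω)) ∂P
      = ∫ ω, ψ (fun n => τ n ω) *
        (Complex.exp (-(lam * (1 - pgf P (a 1) z₁)) * (T₁ fun n => τ n ω)) *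
        Complex.exp (-(lam * (1 - pgf P (a 1) z₂)) *
          ((T₂ fun n => τ n ω) - T₁ fun n => τ n ω : ℝ)) *
        Complex.exp (-(lam * (1 - pgf P (a 1) z₃)) *
          ((T₃ fun n => τ n ω) - T₂ fun n => τ n ω : ℝ))) ∂P := by
  -- A measurable substitute for evaluating the path at a random time, almost surely equal to it.
  let R : (ℕ → ℝ) × (ℝ → ℕ) → ((ℕ → ℝ) → ℝ) → ℕ := fun p T => rationalRightLimit p.2 (T p.1)
  have hR : ∀ {T}, Measurable T → Measurable fun p => R p T := fun hT =>
    measurable_rationalRightLimit_uncurry.comp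
      (measurable_snd.prodMk (hT.comp measurable_fst))
  have h := integral_eq_integral_integral_of_indepFun (P := P)
    (X := fun ω n => τ n ω) (Y := fun ω s => markedProcess t a s ω)
    (measurable_pi_lambda _ hτ) (measurable_pi_lambda _ fun s =>
      measurable_markedProcess_comp hA.points.measurable hA.measurable_mark measurable_const)
    hindep
    (f := fun p => ψ p.1 * (z₁ ^ R p T₁ * z₂ ^ (R p T₂ - R p T₁) * z₃ ^ (R p T₃ - R p T₂)))
    ((hψ.comp measurable_fst).mul ((((measurable_pow_nat z₁).comp (hR hT₁)).mul
      ((measurable_pow_nat z₂).comp ((hR hT₂).sub (hR hT₁)))).mul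
      ((measurable_pow_nat z₃).comp ((hR hT₃).sub (hR hT₂)))))
    (fun ω _ => by
      rw [norm_mul]
      exact mul_le_one₀ (hψ1 ω) (norm_nonneg _)
        (norm_pow_mul_pow_mul_pow_le_one hz₁ hz₂ hz₃ _ _ _))
  have hae := hA.points.ae_finite
  refine (integral_congr_ae ?_).trans (h.trans (integral_congr_ae ?_))
  · filter_upwards [hae] with ω hω
    simp only [R, rationalRightLimit_markedProcess a hω]
  · refine Filter.Eventually.of_forall fun ω => ?_
    simp only
    rw [← hA.integral_increments hlam hz₁ hz₂ hz₃ (h₁ ω) (h₁₂ ω) (h₂₃ ω), ← integral_const_mul]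
    refine integral_congr_ae ?_
    filter_upwards [hae] with ω' hω'
    simp only [R, rationalRightLimit_markedProcess a hω']

end Observed

theorem eq_sum_gap {Ω : Type*} (τ : ℕ → Ω → ℝ) (n : ℕ) (ω : Ω) :
    τ n ω = ∑ i ∈ Finset.range (n + 1), gap τ i ω := by
  induction n with
  | zero => simp [gap, prevValue]
  | succ n ih => rw [Finset.sum_range_succ, ← ih]; simp [gap, prevValue]

/-! ### Laplace transforms of renewal epochs -/

section Renewal

variable {Ω : Type*} [MeasurableSpace Ω] {P : Measure Ω} {τ : ℕ → Ω → ℝ}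

theorem norm_exp_neg_mul_le_one {c : ℂ} (hc : 0 ≤ c.re) {r : ℝ} (hr : 0 ≤ r) :
    ‖Complex.exp (-c * r)‖ ≤ 1 := by
  rw [Complex.norm_exp, Real.exp_le_one_iff]
  simp
  positivity

theorem measurable_exp_neg_mul (c : ℂ) : Measurable fun r : ℝ => Complex.exp (-c * r) := by
  fun_prop

theorem IsDelayedRenewal.nonneg (h : IsDelayedRenewal P τ) (n : ℕ) (ω : Ω) : 0 ≤ τ n ω := by
  rw [eq_sum_gap τ]
  exact Finset.sum_nonneg fun i _ => h.gap_nonneg i ω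

theorem IsDelayedRenewal.le_succ (h : IsDelayedRenewal P τ) (n : ℕ) (ω : Ω) :
    τ n ω ≤ τ (n + 1) ω := by
  have := h.gap_nonneg (n + 1) ω
  simpa [gap, prevValue] using this

theorem measurable_prevValue {R : Type*} [Zero R] [MeasurableSpace R] {f : ℕ → Ω → R}
    (hf : ∀ n, Measurable (f n)) : ∀ n, Measurable (prevValue f n)
  | 0 => measurable_const
  | n + 1 => hf n

theorem IsDelayedRenewal.measurable_gap (h : IsDelayedRenewal P τ) (n : ℕ) :
    Measurable (gap τ n) :=
  (h.measurable n).sub (measurable_prevValue h.measurable n)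

/-- `τₙ` is the sum of the gaps `0, …, n`, all independent of the gap `n + 1`. The power `n` is the
source of the geometric series. -/
theorem IsDelayedRenewal.integral_exp_mul_exp_gap (h : IsDelayedRenewal P τ) (c d : ℂ) (n : ℕ) :
    ∫ ω, Complex.exp (-c * τ n ω) * Complex.exp (-d * gap τ (n + 1) ω) ∂P
      = (∫ ω, Complex.exp (-c * gap τ 0 ω) ∂P) * (∫ ω, Complex.exp (-c * gap τ 1 ω) ∂P) ^ n *
        ∫ ω, Complex.exp (-d * gap τ 1 ω) ∂P := by
  let e : ℕ → ℂ := fun i => if i = n + 1 then d else c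
  have he : ∀ i ∈ Finset.range (n + 1), e i = c := fun i hi => by
    have := Finset.mem_range.1 hi
    simp only [e, if_neg this.ne]
  have hprod := iIndepFun.integral_finset_prod_comp h.indep_gap h.measurable_gap
    (Finset.range (n + 2)) (f := fun i r => Complex.exp (-e i * r))
    (fun i => measurable_exp_neg_mul _)
  have hid : ∀ (b : ℂ) (i : ℕ), ∫ ω, Complex.exp (-b * gap τ (i + 1) ω) ∂P
      = ∫ ω, Complex.exp (-b * gap τ 1 ω) ∂P := fun b i =>
    ((h.identDistrib_gap i).comp (measurable_exp_neg_mul b)).integral_eq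
  have hl : ∀ ω, Complex.exp (-c * τ n ω) * Complex.exp (-d * gap τ (n + 1) ω)
      = ∏ i ∈ Finset.range (n + 2), Complex.exp (-e i * gap τ i ω) := by
    intro ω
    rw [Finset.prod_range_succ, Finset.prod_congr rfl fun i hi => by rw [he i hi],
      ← Complex.exp_sum, ← Finset.mul_sum, eq_sum_gap τ n ω]
    simp [e]
  simp only [hl]
  rw [hprod, Finset.prod_range_succ, Finset.prod_congr rfl fun i hi => by rw [he i hi],
    Finset.prod_range_succ']
  simp only [hid, Finset.prod_const, Finset.card_range]
  simp only [e, if_true]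
  ring

theorem IsDelayedRenewal.integral_exp [IsProbabilityMeasure P] (h : IsDelayedRenewal P τ) (c : ℂ)
    (n : ℕ) :
    ∫ ω, Complex.exp (-c * τ n ω) ∂P
      = (∫ ω, Complex.exp (-c * gap τ 0 ω) ∂P) * (∫ ω, Complex.exp (-c * gap τ 1 ω) ∂P) ^ n := by
  simpa using h.integral_exp_mul_exp_gap c 0 n

theorem integral_lt_one_of_le_one [IsProbabilityMeasure P] {f : Ω → ℝ} (hf : Integrable f P)
    (hle : ∀ ω, f ω ≤ 1) (hne : ¬ ∀ᵐ ω ∂P, f ω = 1) : ∫ ω, f ω ∂P < 1 := by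
  refine lt_of_le_of_ne ?_ fun heq => hne ?_
  · simpa using integral_mono hf (integrable_const (μ := P) (1 : ℝ)) hle
  · have h1 : ∫ ω, (1 - f ω) ∂P = 0 := by
      rw [integral_sub (integrable_const _) hf, heq]; simp
    rw [integral_eq_zero_iff_of_nonneg (fun ω => sub_nonneg.2 (hle ω))
      ((integrable_const _).sub hf)] at h1
    filter_upwards [h1] with ω hω
    have : 1 - f ω = 0 := hω
    linarith

/-- The Laplace transform of a nonnegative variable that is not a.s. `0` has modulus less than `1`
in the open right half-plane. -/
theorem norm_integral_exp_neg_mul_lt_one [IsProbabilityMeasure P] {X : Ω → ℝ} (hX : Measurable X)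
    (h0 : ∀ ω, 0 ≤ X ω) (hne : ¬ ∀ᵐ ω ∂P, X ω = 0) {c : ℂ} (hc : 0 < c.re) :
    ‖∫ ω, Complex.exp (-c * X ω) ∂P‖ < 1 := by
  have hnorm : ∀ ω, ‖Complex.exp (-c * X ω)‖ = Real.exp (-(c.re * X ω)) := fun ω => by
    rw [Complex.norm_exp]; simp
  have hle : ∀ ω, Real.exp (-(c.re * X ω)) ≤ 1 := fun ω => by
    rw [Real.exp_le_one_iff]
    have := h0 ω
    have : 0 ≤ c.re * X ω := by positivity
    linarith
  have hint : Integrable (fun ω => Real.exp (-(c.re * X ω))) P :=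
    Integrable.of_bound (by fun_prop) 1 (Filter.Eventually.of_forall fun ω => by
      rw [Real.norm_of_nonneg (Real.exp_nonneg _)]; exact hle ω)
  refine (norm_integral_le_integral_norm _).trans_lt ?_
  simp only [hnorm]
  refine integral_lt_one_of_le_one hint hle fun h1 => hne ?_
  filter_upwards [h1] with ω hω
  rw [Real.exp_eq_one_iff] at hω
  have : c.re * X ω = 0 := by linarith
  exact (mul_eq_zero.1 this).resolve_left hc.ne'

end Renewal

/-! ### Bounds for probability generating functions -/

section GeneratingFunction

variable {Ω : Type*} [MeasurableSpace Ω] {P : Measure Ω} [IsProbabilityMeasure P] {b : Ω → ℕ}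

theorem norm_pgf_lt_one (hb : Measurable b) (hne : ¬ ∀ᵐ ω ∂P, b ω = 0) {z : ℂ} (hz : ‖z‖ < 1) :
    ‖pgf P b z‖ < 1 := by
  refine (norm_integral_le_integral_norm _).trans_lt ?_
  have hle : ∀ ω, ‖z ^ b ω‖ ≤ 1 := fun ω => by
    rw [norm_pow]; exact pow_le_one₀ (norm_nonneg _) hz.le
  refine integral_lt_one_of_le_one
    (integrable_of_norm_le_one ((measurable_pow_nat z).comp hb) hle).norm hle fun h => hne ?_
  filter_upwards [h] with ω hω
  by_contra h0
  rw [norm_pow] at hω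
  exact (pow_lt_one₀ (norm_nonneg _) hz h0).ne hω

/-- The integrand `z^b - 0^b` vanishes where `b = 0` and is `z^b` elsewhere. The estimate keeps the
denominator of `B₁` away from 0 for small `s`. -/
theorem norm_pgf_sub_pgf_zero_le (hb : Measurable b) {z : ℂ} (hz : ‖z‖ ≤ 1) :
    ‖pgf P b z - pgf P b 0‖ ≤ ‖z‖ := by
  have hi : ∀ z : ℂ, ‖z‖ ≤ 1 → Integrable (fun ω => z ^ b ω) P := fun z hz =>
    integrable_of_norm_le_one ((measurable_pow_nat z).comp hb) fun ω => by
      rw [norm_pow]; exact pow_le_one₀ (norm_nonneg _) hz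
  rw [pgf, pgf, ← integral_sub (hi z hz) (hi 0 (by simp))]
  have := norm_integral_le_of_norm_le_const (μ := P) (f := fun ω => z ^ b ω - 0 ^ b ω) (C := ‖z‖)
    (Filter.Eventually.of_forall fun ω => by
      rcases Nat.eq_zero_or_pos (b ω) with h | h
      · simp [h]
      · rw [zero_pow h.ne', sub_zero, norm_pow]
        exact pow_le_of_le_one (norm_nonneg _) hz h.ne')
  simpa using this

end GeneratingFunction

/-- The exponent `λ (1 - g(z))` of the marked Poisson process. -/
noncomputable def levyExponent {Ω : Type*} [MeasurableSpace Ω] (P : Measure Ω) (lam : ℝ)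
    (b : Ω → ℕ) (z : ℂ) : ℂ := lam * (1 - pgf P b z)

/-- The Laplace transform `E[e^{-c Δₙ}]` of the `n`-th gap. -/
noncomputable def gapLaplace {Ω : Type*} [MeasurableSpace Ω] (P : Measure Ω) (τ : ℕ → Ω → ℝ)
    (n : ℕ) (c : ℂ) : ℂ := ∫ ω, Complex.exp (-c * gap τ n ω) ∂P

/-! ### Joint transforms through Laplace transforms of the gaps -/

section Transforms

variable {Ω : Type*} [MeasurableSpace Ω] {P : Measure Ω} [IsProbabilityMeasure P] {lam : ℝ}
  {t : ℕ → Ω → ℝ} {a : ℕ → Ω → ℕ} {τ : ℕ → Ω → ℝ}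

theorem levyExponent_re_nonneg (hlam : 0 ≤ lam) (b : Ω → ℕ) {z : ℂ} (hz : ‖z‖ ≤ 1) :
    0 ≤ (levyExponent P lam b z).re := by
  have h1 := (Complex.re_le_norm _).trans (norm_pgf_le_one (P := P) b hz)
  simp only [levyExponent, Complex.re_ofReal_mul, Complex.sub_re, Complex.one_re]
  exact mul_nonneg hlam (by linarith)

theorem levyExponent_re_pos (hlam : 0 < lam) {b : Ω → ℕ} (hb : Measurable b)
    (hne : ¬ ∀ᵐ ω ∂P, b ω = 0) {z : ℂ} (hz : ‖z‖ < 1) :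
    0 < (levyExponent P lam b z).re := by
  have h1 := (Complex.re_le_norm _).trans_lt (norm_pgf_lt_one (P := P) hb hne hz)
  simp only [levyExponent, Complex.re_ofReal_mul, Complex.sub_re, Complex.one_re]
  exact mul_pos hlam (by linarith)

/-- Given the gap, the increment over it contributes `e^{-β(z) Δ₀}`, so the transform depends on `z`
and `c` only through `c + β(z)`. -/
theorem jointTransform_zero_eq (hA : IsMarkedPoisson P lam t a) (hlam : 0 ≤ lam)
    (hτ : IsDelayedRenewal P τ)
    (hindep : IndepFun (fun ω n => τ n ω) (fun ω s => markedProcess t a s ω) P)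
    {z c : ℂ} (hz : ‖z‖ ≤ 1) (hc : 0 ≤ c.re) :
    jointTransform P (markedProcess t a) τ 0 z c
      = gapLaplace P τ 0 (c + levyExponent P lam (a 1) z) := by
  have h := hA.integral_random_times hlam hτ.measurable hindep hz hz hz
    (ψ := fun p => Complex.exp (-c * p 0)) (by fun_prop)
    (fun ω => norm_exp_neg_mul_le_one hc (hτ.nonneg 0 ω))
    (T₁ := fun p => p 0) (T₂ := fun p => p 0) (T₃ := fun p => p 0) (by fun_prop) (by fun_prop)
    (by fun_prop) (hτ.nonneg 0) (fun _ => le_rfl) (fun _ => le_rfl)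
  unfold jointTransform gapLaplace
  convert h using 2
  · ext ω
    simp only [obsIncrement, observed, prevValue, gap, sub_zero, Nat.sub_self, pow_zero, mul_one,
      Nat.sub_zero]
    ring
  · ext ω
    simp only [gap, prevValue, levyExponent, sub_self, sub_zero, Complex.ofReal_zero, mul_zero,
      Complex.exp_zero, mul_one, ← Complex.exp_add]
    congr 1
    ring

theorem jointTransform_one_eq (hA : IsMarkedPoisson P lam t a) (hlam : 0 ≤ lam)
    (hτ : IsDelayedRenewal P τ)
    (hindep : IndepFun (fun ω n => τ n ω) (fun ω s => markedProcess t a s ω) P)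
    {z c : ℂ} (hz : ‖z‖ ≤ 1) (hc : 0 ≤ c.re) :
    jointTransform P (markedProcess t a) τ 1 z c
      = gapLaplace P τ 1 (c + levyExponent P lam (a 1) z) := by
  have h1 : ‖(1 : ℂ)‖ ≤ 1 := by simp
  have hg : pgf P (a 1) 1 = 1 := by simp [pgf]
  -- The base 1 discards the increment over `[0, τ₀]` and leaves `X₁` alone.
  have h := hA.integral_random_times hlam hτ.measurable hindep h1 hz hz
    (ψ := fun p => Complex.exp (-c * (p 1 - p 0 : ℝ))) (by fun_prop)
    (fun ω => norm_exp_neg_mul_le_one hc (hτ.gap_nonneg 1 ω))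
    (T₁ := fun p => p 0) (T₂ := fun p => p 1) (T₃ := fun p => p 1) (by fun_prop) (by fun_prop)
    (by fun_prop) (hτ.nonneg 0) (hτ.le_succ 0) (fun _ => le_rfl)
  unfold jointTransform gapLaplace
  convert h using 2
  · ext ω
    simp only [obsIncrement, observed, prevValue, gap, Nat.sub_self, pow_zero, mul_one,
      one_pow, one_mul]
    ring
  · ext ω
    simp only [gap, prevValue, levyExponent, sub_self, hg, Complex.ofReal_zero, mul_zero,
      Complex.exp_zero, mul_one, neg_zero, zero_mul, one_mul, ← Complex.exp_add]
    congr 1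
    ring

theorem integral_pow_observed (hA : IsMarkedPoisson P lam t a) (hlam : 0 ≤ lam)
    (hτ : IsDelayedRenewal P τ)
    (hindep : IndepFun (fun ω n => τ n ω) (fun ω s => markedProcess t a s ω) P)
    {z : ℂ} (hz : ‖z‖ ≤ 1) (n : ℕ) :
    ∫ ω, z ^ observed (markedProcess t a) τ n ω ∂P
      = gapLaplace P τ 0 (levyExponent P lam (a 1) z) *
        gapLaplace P τ 1 (levyExponent P lam (a 1) z) ^ n := by
  have h := hA.integral_random_times hlam hτ.measurable hindep hz hz hz
    (ψ := fun _ => 1) measurable_const (fun ω => by simp)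
    (T₁ := fun p => p n) (T₂ := fun p => p n) (T₃ := fun p => p n) (by fun_prop) (by fun_prop)
    (by fun_prop) (hτ.nonneg n) (fun _ => le_rfl) (fun _ => le_rfl)
  rw [gapLaplace, gapLaplace, ← hτ.integral_exp]
  convert h using 2
  · ext ω
    simp [observed]
  · ext ω
    simp [levyExponent]

theorem norm_gapLaplace_one_lt_one (hτ : IsDelayedRenewal P τ)
    (hΔ : ¬ ∀ᵐ ω ∂P, gap τ 1 ω = 0) {c : ℂ} (hc : 0 < c.re) : ‖gapLaplace P τ 1 c‖ < 1 :=
  norm_integral_exp_neg_mul_lt_one (hτ.measurable_gap 1) (hτ.gap_nonneg 1) hΔ hc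

end Transforms

/-! ### Laplace integrals in time -/

section Laplace

variable {Ω : Type*} [MeasurableSpace Ω] {P : Measure Ω} [IsProbabilityMeasure P]

theorem integrable_exp_neg_mul_Ici {θ : ℂ} (hθ : 0 < θ.re) :
    Integrable (fun r : ℝ => Complex.exp (-θ * r)) (volume.restrict (Set.Ici 0)) := by
  rw [← IntegrableOn, integrableOn_Ici_iff_integrableOn_Ioi]
  exact integrableOn_exp_mul_complex_Ioi (by simpa using hθ) 0

theorem integrable_exp_neg_mul_prod {θ : ℂ} (hθ : 0 < θ.re) {f : ℝ × Ω → ℂ} (hf : Measurable f)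
    {C : ℝ} (hbd : ∀ r, 0 ≤ r → ∀ ω, ‖f (r, ω)‖ ≤ C) :
    Integrable (fun p : ℝ × Ω => Complex.exp (-θ * p.1) * f p)
      ((volume.restrict (Set.Ici 0)).prod P) := by
  refine ((integrable_exp_neg_mul_Ici hθ).comp_fst P).mul_bdd (c := C) hf.aestronglyMeasurable ?_
  have : ∀ᵐ r ∂(volume.restrict (Set.Ici (0 : ℝ))), 0 ≤ r := ae_restrict_mem measurableSet_Ici
  filter_upwards [Measure.quasiMeasurePreserving_fst.ae this] with p hp
  exact hbd p.1 hp p.2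

theorem integral_indicator_exp_neg_mul {κ : ℂ} (hκ : κ ≠ 0) {T : ℝ} (hT : 0 ≤ T) :
    ∫ r in Set.Ici (0 : ℝ), (if r < T then Complex.exp (-κ * r) else 0)
      = (1 - Complex.exp (-κ * T)) / κ := by
  have h1 : (fun r : ℝ => if r < T then Complex.exp (-κ * r) else 0)
      = (Set.Iio T).indicator fun r : ℝ => Complex.exp (-κ * r) := by
    ext r; simp [Set.indicator]
  rw [h1, setIntegral_indicator measurableSet_Iio, Set.Ici_inter_Iio,
    integral_Ico_eq_integral_Ioc, ← intervalIntegral.integral_of_le hT,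
    integral_exp_mul_complex (neg_ne_zero.2 hκ)]
  rw [div_eq_div_iff (neg_ne_zero.2 hκ) hκ]
  simp
  ring

end Laplace

/-- Generating function in the threshold `m` of the value `C n` attached to the index `n` at which
the nondecreasing sequence `N` passes `m`, i.e. `N n ≤ m < N (n + 1)`. -/
theorem hasSum_mul_pow_sub_pow {N : ℕ → ℕ} (hN : Monotone N) (hex : ∀ m, ∃ n, m < N n)
    {C V : ℕ → ℂ} (hV : ∀ m, ‖V m‖ ≤ 1) (hV0 : ∀ m, m < N 0 → V m = 0)
    (hVC : ∀ m n, N n ≤ m → m < N (n + 1) → V m = C n) {s : ℂ} (hs : ‖s‖ < 1) :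
    HasSum (fun n => C n * (s ^ N n - s ^ N (n + 1))) ((1 - s) * ∑' m, s ^ m * V m) := by
  classical
  -- A double series supported on the graph of `i`, where each threshold meets at most one index.
  -- Summing it along `m` or along `n` first gives the two sides.
  let f : ℕ × ℕ → ℂ := fun q => if N q.1 ≤ q.2 ∧ q.2 < N (q.1 + 1) then s ^ q.2 * C q.1 else 0
  let i : ℕ → ℕ × ℕ := fun m => (Nat.find (hex m) - 1, m)
  have hi : Function.Injective i := fun m m' h => (Prod.mk.inj h).2
  have hfind : ∀ m n, N n ≤ m → m < N (n + 1) → Nat.find (hex m) = n + 1 := by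
    intro m n h1 h2
    refine (Nat.find_eq_iff _).2 ⟨h2, fun j hj => not_lt.2 ?_⟩
    exact (hN (Nat.lt_succ_iff.1 hj)).trans h1
  have hsupp : ∀ q, q ∉ Set.range i → f q = 0 := by
    rintro ⟨n, m⟩ hq
    refine if_neg fun h => hq ⟨m, ?_⟩
    simp [i, hfind m n h.1 h.2]
  have hfi : f ∘ i = fun m => s ^ m * V m := by
    ext m
    simp only [Function.comp, f, i]
    -- If passage occurs at index 0, the truncated predecessor is again 0, but `m < N 0` makes both
    -- sides vanish.
    rcases Nat.eq_zero_or_pos (Nat.find (hex m)) with h0 | hpos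
    · have hm : m < N 0 := by have := Nat.find_spec (hex m); rwa [h0] at this
      rw [h0, hV0 m hm, if_neg fun h => not_le.2 hm h.1, mul_zero]
    · have h1 : N (Nat.find (hex m) - 1) ≤ m :=
        not_lt.1 (Nat.find_min (hex m) (Nat.sub_lt hpos one_pos))
      have h2 : m < N (Nat.find (hex m) - 1 + 1) := by
        rw [Nat.sub_add_cancel hpos]; exact Nat.find_spec (hex m)
      rw [if_pos ⟨h1, h2⟩, hVC m _ h1 h2]
  have hsum : Summable fun m => s ^ m * V m := by
    refine Summable.of_norm_bounded (summable_geometric_of_lt_one (norm_nonneg s) hs) fun m => ?_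
    rw [norm_mul, norm_pow]
    exact mul_le_of_le_one_right (by positivity) (hV m)
  have hf : HasSum f (∑' m, s ^ m * V m) := by
    rw [← hi.hasSum_iff hsupp, hfi]
    exact hsum.hasSum
  have hfib : ∀ n, HasSum (fun m => f (n, m)) (∑ m ∈ Finset.Ico (N n) (N (n + 1)), s ^ m * C n) := by
    intro n
    have := hasSum_sum_of_ne_finset_zero (f := fun m => f (n, m))
      (s := Finset.Ico (N n) (N (n + 1))) (L := SummationFilter.unconditional ℕ) (fun m hm => by
        refine if_neg fun h => hm (Finset.mem_Ico.2 h))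
    convert this using 1
    exact Finset.sum_congr rfl fun m hm => (if_pos (Finset.mem_Ico.1 hm)).symm
  have hgeom : (fun n => C n * (s ^ N n - s ^ N (n + 1)))
      = fun n => (1 - s) * ∑ m ∈ Finset.Ico (N n) (N (n + 1)), s ^ m * C n := by
    ext n
    rw [← Finset.sum_mul]
    have := geom_sum_Ico_mul s (hN (Nat.le_succ n))
    linear_combination C n * this
  rw [hgeom]
  exact (hf.prod_fiberwise hfib).mul_left (1 - s)

/-! ### The exit index and the pre-exit variable -/

section ExitIndex

variable {Ω : Type*}

theorem exitIndex_eq_zero {A : ℝ → Ω → ℕ} {τ : ℕ → Ω → ℝ} {m : ℕ} {ω : Ω}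
    (h : m < observed A τ 0 ω) : exitIndex A τ m ω = 0 :=
  Nat.sInf_eq_zero.2 (Or.inl h)

theorem exitIndex_eq_succ {A : ℝ → Ω → ℕ} {τ : ℕ → Ω → ℝ} {m n : ℕ} {ω : Ω}
    (hmono : Monotone fun n => observed A τ n ω) (h1 : observed A τ n ω ≤ m)
    (h2 : m < observed A τ (n + 1) ω) : exitIndex A τ m ω = n + 1 := by
  have hne : {n | m < observed A τ n ω}.Nonempty := ⟨n + 1, h2⟩
  refine le_antisymm (Nat.sInf_le h2) ?_
  by_contra hlt
  have hmem : m < observed A τ (sInf {n | m < observed A τ n ω}) ω := Nat.sInf_mem hne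
  have : sInf {n | m < observed A τ n ω} ≤ n := Nat.lt_succ_iff.1 (not_le.1 hlt)
  exact absurd (hmem.trans_le ((hmono this).trans h1)) (lt_irrefl _)

variable [MeasurableSpace Ω]

theorem measurable_exitIndex {A : ℝ → Ω → ℕ} {τ : ℕ → Ω → ℝ}
    (h : ∀ n, Measurable (observed A τ n)) (m : ℕ) : Measurable (exitIndex A τ m) := by
  refine measurable_of_Iic fun c => ?_
  -- The intersection collects the paths that never exceed `m`; there `sInf ∅ = 0`, which lies in
  -- every `Set.Iic c`.
  have : exitIndex A τ m ⁻¹' Set.Iic c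
      = (⋃ n ∈ Set.Iic c, {ω | m < observed A τ n ω}) ∪ ⋂ n, {ω | m < observed A τ n ω}ᶜ := by
    ext ω
    simp only [Set.mem_preimage, Set.mem_Iic, Set.mem_union, Set.mem_iUnion, Set.mem_ofPred_eq,
      Set.mem_iInter, Set.mem_compl_iff, exists_prop]
    rcases Set.eq_empty_or_nonempty {n | m < observed A τ n ω} with he | hne
    · have h0 : exitIndex A τ m ω = 0 := Nat.sInf_eq_zero.2 (Or.inr he)
      exact iff_of_true (h0 ▸ Nat.zero_le c) (Or.inr fun n hn => by
        have : n ∈ {n | m < observed A τ n ω} := hn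
        simp [he] at this)
    · constructor
      · intro hc
        exact Or.inl ⟨_, hc, Nat.sInf_mem hne⟩
      · rintro (⟨n, hn, hmn⟩ | hall)
        · exact le_trans (Nat.sInf_le (show n ∈ {n | m < observed A τ n ω} from hmn)) hn
        · obtain ⟨n, hn⟩ := hne
          exact absurd hn (hall n)
  rw [this]
  refine (MeasurableSet.biUnion (Set.to_countable _) fun n _ =>
    measurableSet_lt measurable_const (h n)).union (MeasurableSet.iInter fun n =>
    (measurableSet_lt measurable_const (h n)).compl)

theorem Measurable.comp_index {R : Type*} [MeasurableSpace R] {f : ℕ → Ω → R}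
    (hf : ∀ n, Measurable (f n)) {ν : Ω → ℕ} (hν : Measurable ν) :
    Measurable fun ω => f (ν ω) ω :=
  (measurable_from_prod_countable_right (f := fun p : ℕ × Ω => f p.1 p.2) hf).comp
    (hν.prodMk measurable_id)

variable {t : ℕ → Ω → ℝ} {a : ℕ → Ω → ℕ} {τ : ℕ → Ω → ℝ}

theorem measurable_observed (ht : ∀ k, Measurable (t k)) (ha : ∀ k, Measurable (a k))
    (hτ : ∀ n, Measurable (τ n)) (n : ℕ) : Measurable (observed (markedProcess t a) τ n) :=
  measurable_markedProcess_comp ht ha (hτ n)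

theorem measurable_preExitVariable (ht : ∀ k, Measurable (t k)) (ha : ∀ k, Measurable (a k))
    (hτ : ∀ n, Measurable (τ n)) (m : ℕ) (u v w x y : ℂ) :
    Measurable fun p : ℝ × Ω => preExitVariable (markedProcess t a) τ m u v w x y p.1 p.2 := by
  have hobs := measurable_observed ht ha hτ
  have hν := measurable_exitIndex hobs m
  have hpτ := Measurable.comp_index (measurable_prevValue hτ) hν
  have hpA := Measurable.comp_index (measurable_prevValue hobs) hν
  have hAν := Measurable.comp_index hobs hν
  have hgap := Measurable.comp_index
    (fun n => (hτ n).sub (measurable_prevValue hτ n) : ∀ n, Measurable (gap τ n)) hν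
  have heq : (fun p : ℝ × Ω => preExitVariable (markedProcess t a) τ m u v w x y p.1 p.2)
      = {p : ℝ × Ω | p.1 < prevValue τ (exitIndex (markedProcess t a) τ m p.2) p.2}.indicator
        (fun p => u ^ prevValue (observed (markedProcess t a) τ)
            (exitIndex (markedProcess t a) τ m p.2) p.2 *
          v ^ observed (markedProcess t a) τ (exitIndex (markedProcess t a) τ m p.2) p.2 *
          Complex.exp (-w * ((prevValue τ (exitIndex (markedProcess t a) τ m p.2) p.2 : ℝ) : ℂ)
            - x * ((gap τ (exitIndex (markedProcess t a) τ m p.2) p.2 : ℝ) : ℂ)) *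
          y ^ markedProcess t a p.1 p.2) := by
    ext p
    simp only [preExitVariable, Set.indicator, Set.mem_ofPred_eq]
  rw [heq]
  refine Measurable.indicator ?_ (measurableSet_lt measurable_fst (hpτ.comp measurable_snd))
  refine ((((measurable_pow_nat u).comp (hpA.comp measurable_snd)).mul
    ((measurable_pow_nat v).comp (hAν.comp measurable_snd))).mul ?_).mul
    ((measurable_pow_nat y).comp (measurable_markedProcess_uncurry ht ha))
  have h1 : Measurable fun p : ℝ × Ω =>
    prevValue τ (exitIndex (markedProcess t a) τ m p.2) p.2 := hpτ.comp measurable_snd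
  have h2 : Measurable fun p : ℝ × Ω =>
    gap τ (exitIndex (markedProcess t a) τ m p.2) p.2 := hgap.comp measurable_snd
  fun_prop

theorem norm_exp_neg_sub_le_one {w x : ℂ} (hw : 0 ≤ w.re) (hx : 0 ≤ x.re) {r q : ℝ} (hr : 0 ≤ r)
    (hq : 0 ≤ q) : ‖Complex.exp (-w * r - x * q)‖ ≤ 1 := by
  have : -w * (r : ℂ) - x * q = -w * r + -x * q := by ring
  rw [this, Complex.exp_add, norm_mul]
  exact mul_le_one₀ (norm_exp_neg_mul_le_one hw hr) (norm_nonneg _)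
    (norm_exp_neg_mul_le_one hx hq)

theorem norm_preExitVariable_le_one {P : Measure Ω} (hτ : IsDelayedRenewal P τ) (A : ℝ → Ω → ℕ)
    (m : ℕ) {u v w x y : ℂ} (hu : ‖u‖ ≤ 1) (hv : ‖v‖ ≤ 1) (hy : ‖y‖ ≤ 1) (hw : 0 ≤ w.re)
    (hx : 0 ≤ x.re) (r : ℝ) (ω : Ω) : ‖preExitVariable A τ m u v w x y r ω‖ ≤ 1 := by
  have hprev : ∀ n, 0 ≤ prevValue τ n ω := fun n => by
    cases n with
    | zero => exact le_rfl
    | succ n => exact hτ.nonneg n ω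
  rw [preExitVariable]
  refine (norm_indicator_le_norm_self _ _).trans ?_
  simp only [norm_mul, norm_pow]
  refine mul_le_one₀ (mul_le_one₀ (mul_le_one₀ (pow_le_one₀ (norm_nonneg _) hu) (by positivity)
    (pow_le_one₀ (norm_nonneg _) hv)) (norm_nonneg _) ?_) (by positivity)
    (pow_le_one₀ (norm_nonneg _) hy)
  exact norm_exp_neg_sub_le_one hw hx (hprev _) (hτ.gap_nonneg _ ω)

end ExitIndex

/-- The variable `z^{Aₙ} y^{A(r)} q^{Xₙ₊₁} e^{-w τₙ - x Δₙ₊₁} 1{r < τₙ}`. -/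
noncomputable def observedTerm {Ω : Type*} (A : ℝ → Ω → ℕ) (τ : ℕ → Ω → ℝ) (n : ℕ)
    (z y q w x : ℂ) (p : ℝ × Ω) : ℂ :=
  if p.1 < τ n p.2 then
    Complex.exp (-w * τ n p.2) * Complex.exp (-x * gap τ (n + 1) p.2) *
      (z ^ observed A τ n p.2 * y ^ A p.1 p.2 * q ^ obsIncrement A τ (n + 1) p.2)
  else 0

/-! ### Expectation and Laplace transform of a single term -/

section ObservedTerm

variable {Ω : Type*} [MeasurableSpace Ω] {P : Measure Ω} {lam : ℝ}
  {t : ℕ → Ω → ℝ} {a : ℕ → Ω → ℕ} {τ : ℕ → Ω → ℝ}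

theorem measurable_observedTerm (ht : ∀ k, Measurable (t k)) (ha : ∀ k, Measurable (a k))
    (hτ : ∀ n, Measurable (τ n)) (n : ℕ) (z y q w x : ℂ) :
    Measurable (observedTerm (markedProcess t a) τ n z y q w x) := by
  have hobs := measurable_observed ht ha hτ
  have hinc : Measurable (obsIncrement (markedProcess t a) τ (n + 1)) :=
    (hobs (n + 1)).sub (hobs n)
  have hgap : Measurable (gap τ (n + 1)) := (hτ (n + 1)).sub (hτ n)
  have h1 : Measurable fun p : ℝ × Ω => τ n p.2 := (hτ n).comp measurable_snd
  have h2 : Measurable fun p : ℝ × Ω => gap τ (n + 1) p.2 := hgap.comp measurable_snd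
  refine Measurable.ite (measurableSet_lt measurable_fst h1) (Measurable.mul (by fun_prop) ?_)
    measurable_const
  exact (((measurable_pow_nat z).comp ((hobs n).comp measurable_snd)).mul
    ((measurable_pow_nat y).comp (measurable_markedProcess_uncurry ht ha))).mul
    ((measurable_pow_nat q).comp (hinc.comp measurable_snd))

/-- The factor `‖z‖ ^ Aₙ` is retained because its expectations are what is summable in `n`. -/
theorem norm_observedTerm_le (hτ : IsDelayedRenewal P τ) (A : ℝ → Ω → ℕ) (n : ℕ)
    {z y q w x : ℂ} (hy : ‖y‖ ≤ 1) (hq : ‖q‖ ≤ 1) (hw : 0 ≤ w.re) (hx : 0 ≤ x.re)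
    (p : ℝ × Ω) : ‖observedTerm A τ n z y q w x p‖ ≤ ‖z‖ ^ observed A τ n p.2 := by
  rw [observedTerm]
  split_ifs
  · simp only [norm_mul, norm_pow]
    have h1 := norm_exp_neg_mul_le_one hw (hτ.nonneg n p.2)
    have h2 := norm_exp_neg_mul_le_one hx (hτ.gap_nonneg (n + 1) p.2)
    refine (mul_le_of_le_one_left (by positivity) (mul_le_one₀ h1 (norm_nonneg _) h2)).trans ?_
    rw [mul_assoc]
    exact mul_le_of_le_one_right (by positivity) (mul_le_one₀ (pow_le_one₀ (norm_nonneg _) hy)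
      (by positivity) (pow_le_one₀ (norm_nonneg _) hq))
  · simp only [norm_zero]; positivity

variable [IsProbabilityMeasure P]

/-- For `r < τₙ`, `z^{Aₙ} y^{A(r)} = (zy)^{A(r)} z^{Aₙ - A(r)}`, which leaves three consecutive
increments with bases `zy`, `z`, `q`. -/
theorem integral_observedTerm (hA : IsMarkedPoisson P lam t a) (hlam : 0 ≤ lam)
    (hτ : IsDelayedRenewal P τ)
    (hindep : IndepFun (fun ω n => τ n ω) (fun ω s => markedProcess t a s ω) P) (n : ℕ)
    {z y q w x : ℂ} (hz : ‖z‖ ≤ 1) (hy : ‖y‖ ≤ 1) (hq : ‖q‖ ≤ 1) (hw : 0 ≤ w.re) (hx : 0 ≤ x.re)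
    {r : ℝ} (hr : 0 ≤ r) :
    ∫ ω, observedTerm (markedProcess t a) τ n z y q w x (r, ω) ∂P
      = ∫ ω, (if r < τ n ω then
          Complex.exp (-w * τ n ω) * Complex.exp (-x * gap τ (n + 1) ω) *
          (Complex.exp (-levyExponent P lam (a 1) (z * y) * r) *
          Complex.exp (-levyExponent P lam (a 1) z * (τ n ω - r : ℝ)) *
          Complex.exp (-levyExponent P lam (a 1) q * gap τ (n + 1) ω)) else 0) ∂P := by
  have hzy : ‖z * y‖ ≤ 1 := by rw [norm_mul]; exact mul_le_one₀ hz (norm_nonneg _) hy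
  have h := hA.integral_random_times hlam hτ.measurable hindep hzy hz hq
    (ψ := fun p => if r < p n then
      Complex.exp (-w * p n) * Complex.exp (-x * (p (n + 1) - p n : ℝ)) else 0)
    (Measurable.ite (measurableSet_lt measurable_const (measurable_pi_apply n)) (by fun_prop)
      measurable_const)
    (fun ω => by
      dsimp only
      split_ifs
      · rw [norm_mul]
        exact mul_le_one₀ (norm_exp_neg_mul_le_one hw (hτ.nonneg n ω)) (norm_nonneg _)
          (norm_exp_neg_mul_le_one hx (hτ.gap_nonneg (n + 1) ω))
      · simp)
    -- The minimum keeps the three times ordered on every path and equals `r` wherever `ψ` is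
    -- nonzero.
    (T₁ := fun p => min r (p n)) (T₂ := fun p => p n) (T₃ := fun p => p (n + 1))
    (by fun_prop) (by fun_prop) (by fun_prop) (fun ω => le_min hr (hτ.nonneg n ω))
    (fun ω => min_le_right _ _) (hτ.le_succ n)
  refine (integral_congr_ae ?_).trans (h.trans (integral_congr_ae ?_))
  · filter_upwards [hA.points.ae_finite] with ω hω
    simp only [observedTerm]
    split_ifs with hrτ
    · have hle := markedProcess_mono a hω hrτ.le
      simp only [min_eq_left hrτ.le, gap, prevValue, obsIncrement, observed]
      obtain ⟨d, hd⟩ := Nat.exists_eq_add_of_le hle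
      simp only at hd
      rw [hd, Nat.add_sub_cancel_left, pow_add, mul_pow]
      ring
    · simp
  · refine Filter.Eventually.of_forall fun ω => ?_
    dsimp only
    split_ifs with hrτ
    · simp only [min_eq_left hrτ.le, gap, prevValue, levyExponent]
    · simp

theorem integral_exp_mul_observedTerm (hA : IsMarkedPoisson P lam t a) (hlam : 0 ≤ lam)
    (hτ : IsDelayedRenewal P τ)
    (hindep : IndepFun (fun ω n => τ n ω) (fun ω s => markedProcess t a s ω) P) (n : ℕ)
    {θ z y q w x : ℂ} (hθ : 0 < θ.re) (hz : ‖z‖ ≤ 1) (hy : ‖y‖ ≤ 1) (hq : ‖q‖ ≤ 1)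
    (hw : 0 ≤ w.re) (hx : 0 ≤ x.re)
    (hκ : θ + lam * pgf P (a 1) z - lam * pgf P (a 1) (z * y) ≠ 0) :
    ∫ p : ℝ × Ω, Complex.exp (-θ * p.1) * observedTerm (markedProcess t a) τ n z y q w x p
        ∂((volume.restrict (Set.Ici 0)).prod P)
      = gapLaplace P τ 1 (x + levyExponent P lam (a 1) q) /
          (θ + lam * pgf P (a 1) z - lam * pgf P (a 1) (z * y)) *
        (gapLaplace P τ 0 (w + levyExponent P lam (a 1) z) *
            gapLaplace P τ 1 (w + levyExponent P lam (a 1) z) ^ n -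
          gapLaplace P τ 0 (θ + w + levyExponent P lam (a 1) (z * y)) *
            gapLaplace P τ 1 (θ + w + levyExponent P lam (a 1) (z * y)) ^ n) := by
  have hzy : ‖z * y‖ ≤ 1 := by rw [norm_mul]; exact mul_le_one₀ hz (norm_nonneg _) hy
  set κ := θ + lam * pgf P (a 1) z - lam * pgf P (a 1) (z * y) with hκdef
  let β := levyExponent P lam (a 1)
  have hβ : ∀ z, ‖z‖ ≤ 1 → 0 ≤ (β z).re := fun z hz => levyExponent_re_nonneg hlam _ hz
  let f : ℝ × Ω → ℂ := fun p => if p.1 < τ n p.2 then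
    Complex.exp (-w * τ n p.2) * Complex.exp (-x * gap τ (n + 1) p.2) *
      (Complex.exp (-β (z * y) * p.1) * Complex.exp (-β z * (τ n p.2 - p.1 : ℝ)) *
        Complex.exp (-β q * gap τ (n + 1) p.2)) else 0
  have hf : Measurable f := by
    have h1 : Measurable fun p : ℝ × Ω => τ n p.2 := (hτ.measurable n).comp measurable_snd
    have h2 : Measurable fun p : ℝ × Ω => gap τ (n + 1) p.2 :=
      (hτ.measurable_gap (n + 1)).comp measurable_snd
    refine Measurable.ite (measurableSet_lt measurable_fst h1) ?_ measurable_const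
    exact (((measurable_exp_neg_mul w).comp h1).mul ((measurable_exp_neg_mul x).comp h2)).mul
      ((((measurable_exp_neg_mul _).comp measurable_fst).mul
        ((measurable_exp_neg_mul _).comp (h1.sub measurable_fst))).mul
        ((measurable_exp_neg_mul _).comp h2))
  have hf1 : ∀ r, 0 ≤ r → ∀ ω, ‖f (r, ω)‖ ≤ 1 := by
    intro r hr ω
    simp only [f]
    split_ifs with h
    · simp only [norm_mul]
      have e1 := norm_exp_neg_mul_le_one hw (hτ.nonneg n ω)
      have e2 := norm_exp_neg_mul_le_one hx (hτ.gap_nonneg (n + 1) ω)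
      have e3 := norm_exp_neg_mul_le_one (hβ _ hzy) hr
      have e4 := norm_exp_neg_mul_le_one (hβ _ hz) (sub_nonneg.2 h.le)
      have e5 := norm_exp_neg_mul_le_one (hβ _ hq) (hτ.gap_nonneg (n + 1) ω)
      exact mul_le_one₀ (mul_le_one₀ e1 (norm_nonneg _) e2) (by positivity)
        (mul_le_one₀ (mul_le_one₀ e3 (norm_nonneg _) e4) (norm_nonneg _) e5)
    · simp
  have hint := integrable_exp_neg_mul_prod (P := P) hθ hf hf1
  have hint' := integrable_exp_neg_mul_prod (P := P) hθ
    (measurable_observedTerm hA.points.measurable hA.measurable_mark hτ.measurable n z y q w x)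
    (C := 1) fun r _ ω => (norm_observedTerm_le hτ _ n hy hq hw hx (r, ω)).trans
      (pow_le_one₀ (norm_nonneg _) hz)
  -- The expectation is taken inside first, to replace the marked process by exponentials; the order
  -- is then reversed to integrate over time for fixed `τ`.
  have hswap : ∫ p : ℝ × Ω, Complex.exp (-θ * p.1) * observedTerm (markedProcess t a) τ n z y q w x p
        ∂((volume.restrict (Set.Ici 0)).prod P)
      = ∫ ω, (∫ r in Set.Ici (0 : ℝ), Complex.exp (-θ * r) * f (r, ω)) ∂P := by
    rw [integral_prod _ hint',
      ← integral_integral_swap (f := fun r ω => Complex.exp (-θ * (r : ℝ)) * f (r, ω)) hint]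
    refine setIntegral_congr_fun measurableSet_Ici fun r hr => ?_
    simp only [integral_const_mul]
    rw [integral_observedTerm hA hlam hτ hindep n hz hy hq hw hx hr]
  have hinner : ∀ ω, ∫ r in Set.Ici (0 : ℝ), Complex.exp (-θ * r) * f (r, ω)
      = κ⁻¹ * (Complex.exp (-(w + β z) * τ n ω) * Complex.exp (-(x + β q) * gap τ (n + 1) ω) -
        Complex.exp (-(θ + w + β (z * y)) * τ n ω) *
          Complex.exp (-(x + β q) * gap τ (n + 1) ω)) := by
    intro ω
    -- The exponents in `r` combine because `κ = θ + β(zy) - β(z)`.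
    have e : ∀ r : ℝ, Complex.exp (-θ * r) * f (r, ω) =
        (Complex.exp (-(w + β z) * τ n ω) * Complex.exp (-(x + β q) * gap τ (n + 1) ω)) *
          (if r < τ n ω then Complex.exp (-κ * r) else 0) := by
      intro r
      simp only [f]
      split_ifs
      · simp only [← Complex.exp_add]
        congr 1
        simp only [hκdef, β, levyExponent]
        push_cast
        ring
      · simp
    simp only [e, integral_const_mul]
    rw [integral_indicator_exp_neg_mul hκ (hτ.nonneg n ω)]
    have e2 : Complex.exp (-(θ + w + β (z * y)) * τ n ω)
        = Complex.exp (-(w + β z) * τ n ω) * Complex.exp (-κ * τ n ω) := by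
      rw [← Complex.exp_add]
      congr 1
      simp only [hκdef, β, levyExponent]
      ring
    rw [e2]
    ring
  have hi : ∀ c : ℂ, 0 ≤ c.re → Integrable (fun ω => Complex.exp (-c * τ n ω) *
      Complex.exp (-(x + β q) * gap τ (n + 1) ω)) P := by
    intro c hc
    have h1 := hτ.measurable n
    have h2 := hτ.measurable_gap (n + 1)
    refine integrable_of_norm_le_one (by fun_prop) fun ω => ?_
    rw [norm_mul]
    refine mul_le_one₀ (norm_exp_neg_mul_le_one hc (hτ.nonneg n ω)) (norm_nonneg _)
      (norm_exp_neg_mul_le_one ?_ (hτ.gap_nonneg (n + 1) ω))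
    simpa using add_nonneg hx (hβ q hq)
  rw [hswap]
  simp only [hinner, integral_const_mul]
  rw [integral_sub (hi _ (by simpa using add_nonneg hw (hβ z hz)))
    (hi _ (by simpa using add_nonneg (add_nonneg hθ.le hw) (hβ _ hzy))),
    hτ.integral_exp_mul_exp_gap, hτ.integral_exp_mul_exp_gap]
  simp only [gapLaplace, β]
  ring

end ObservedTerm

/-- Uniqueness of power series coefficients at 0; analyticity of `φ` itself follows on multiplying
by `1 - s`. -/
theorem analyticAt_and_invD_eq_of_hasSum {φ : ℂ → ℂ} {c : ℕ → ℂ}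
    (h : ∀ᶠ s in nhds (0 : ℂ), HasSum (fun m => s ^ m * c m) ((1 - s)⁻¹ * φ s)) (M : ℕ) :
    AnalyticAt ℂ φ 0 ∧ invD M φ = c M := by
  have hp : HasFPowerSeriesAt (fun s => 1 / (1 - s) * φ s)
      (FormalMultilinearSeries.ofScalars ℂ c) 0 := by
    rw [hasFPowerSeriesAt_iff]
    filter_upwards [h] with s hs
    simpa [FormalMultilinearSeries.coeff_ofScalars] using hs
  have han := hp.analyticAt
  constructor
  · have h1 : AnalyticAt ℂ (fun s : ℂ => (1 - s) * (1 / (1 - s) * φ s)) 0 :=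
      (analyticAt_const.sub analyticAt_id).mul han
    refine h1.congr ?_
    have : ∀ᶠ s in nhds (0 : ℂ), s ≠ 1 := eventually_ne_nhds zero_ne_one
    filter_upwards [this] with s hs
    have : 1 - s ≠ 0 := sub_ne_zero.2 hs.symm
    field_simp
  · have heq := han.hasFPowerSeriesAt.eq_formalMultilinearSeries hp
    have := congrArg (fun p : FormalMultilinearSeries ℂ ℂ ℂ => p.coeff M) heq
    simp only [FormalMultilinearSeries.coeff_ofScalars] at this
    rw [← this, invD]
    ring

/-! ### The series over thresholds along one path -/

section Pointwise

variable {Ω : Type*} [MeasurableSpace Ω] {P : Measure Ω} {t : ℕ → Ω → ℝ} {a : ℕ → Ω → ℕ}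
  {τ : ℕ → Ω → ℝ}

theorem observed_mono (hτ : IsDelayedRenewal P τ) {ω : Ω}
    (hω : ∀ T : ℝ, {k | t k ω ∈ Set.Icc 0 T}.Finite) :
    Monotone fun n => observed (markedProcess t a) τ n ω :=
  monotone_nat_of_le_succ fun n => markedProcess_mono a hω (hτ.le_succ n ω)

/-- The generating function of the pre-exit variables in the threshold, pointwise. -/
theorem hasSum_observedTerm_sub (hτ : IsDelayedRenewal P τ) {ω : Ω}
    (hω : ∀ T : ℝ, {k | t k ω ∈ Set.Icc 0 T}.Finite)
    (hex : ∀ m, ∃ n, m < observed (markedProcess t a) τ n ω)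
    {u v w x y s : ℂ} (hu : ‖u‖ ≤ 1) (hv : ‖v‖ ≤ 1) (hy : ‖y‖ ≤ 1) (hw : 0 ≤ w.re)
    (hx : 0 ≤ x.re) (hs : ‖s‖ < 1) {r : ℝ} (hr : 0 ≤ r) :
    HasSum (fun n => observedTerm (markedProcess t a) τ n (u * v * s) y v w x (r, ω) -
        observedTerm (markedProcess t a) τ n (u * v * s) y (v * s) w x (r, ω))
      ((1 - s) * ∑' m, s ^ m * preExitVariable (markedProcess t a) τ m u v w x y r ω) := by
  set A := markedProcess t a with hAdef
  have hmono : Monotone fun n => observed A τ n ω := observed_mono hτ hω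
  let C : ℕ → ℂ := fun n => if r < τ n ω then
    u ^ observed A τ n ω * v ^ observed A τ (n + 1) ω *
      Complex.exp (-w * τ n ω - x * gap τ (n + 1) ω) * y ^ A r ω else 0
  have h := hasSum_mul_pow_sub_pow hmono hex (C := C)
    (V := fun m => preExitVariable A τ m u v w x y r ω)
    (fun m => norm_preExitVariable_le_one hτ A m hu hv hy hw hx r ω)
    (fun m hm => by
      simp only [preExitVariable]
      rw [Set.indicator_of_notMem]
      simpa [exitIndex_eq_zero hm, prevValue] using hr)
    (fun m n h1 h2 => by
      simp only [preExitVariable, Set.indicator, Set.mem_ofPred_eq,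
        exitIndex_eq_succ hmono h1 h2, C, prevValue])
    hs
  -- Replacing `v` by `vs` in the last factor adds `s^{Xₙ₊₁}` and so raises `s^{Aₙ}` to `s^{Aₙ₊₁}`.
  have hterm : (fun n => observedTerm A τ n (u * v * s) y v w x (r, ω) -
        observedTerm A τ n (u * v * s) y (v * s) w x (r, ω))
      = fun n => C n * (s ^ observed A τ n ω - s ^ observed A τ (n + 1) ω) := by
    ext n
    simp only [observedTerm, C]
    split_ifs
    · obtain ⟨d, hd⟩ := Nat.exists_eq_add_of_le (hmono (Nat.le_succ n))
      have hd' : observed A τ (n + 1) ω = observed A τ n ω + d := hd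
      have hexp : -w * (τ n ω : ℂ) - x * gap τ (n + 1) ω
          = -w * τ n ω + -x * gap τ (n + 1) ω := by ring
      simp only [obsIncrement, prevValue, hd', Nat.add_sub_cancel_left, hexp, Complex.exp_add]
      ring
    · simp
  rw [hterm]
  exact h

end Pointwise

/-! ### Summation, almost sure exit and the transformed series -/

section Laplace

variable {Ω : Type*} [MeasurableSpace Ω] {P : Measure Ω} [IsProbabilityMeasure P] {lam : ℝ}
  {t : ℕ → Ω → ℝ} {a : ℕ → Ω → ℕ} {τ : ℕ → Ω → ℝ}

/-- The series is geometric with ratio `E[e^{-β(s)Δ₁}]`, of modulus below 1 since `Re β(s) > 0` and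
`Δ₁` is not almost surely 0. -/
theorem summable_integral_pow_observed (hA : IsMarkedPoisson P lam t a) (hlam : 0 < lam)
    (ha : ¬ ∀ᵐ ω ∂P, a 1 ω = 0) (hτ : IsDelayedRenewal P τ) (hΔ : ¬ ∀ᵐ ω ∂P, gap τ 1 ω = 0)
    (hindep : IndepFun (fun ω n => τ n ω) (fun ω s => markedProcess t a s ω) P)
    {s : ℝ} (hs0 : 0 ≤ s) (hs : s < 1) :
    Summable fun n => ∫ ω, s ^ observed (markedProcess t a) τ n ω ∂P := by
  have hn : ‖(s : ℂ)‖ < 1 := by rwa [Complex.norm_of_nonneg hs0]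
  have hγ := norm_gapLaplace_one_lt_one hτ hΔ
    (levyExponent_re_pos (P := P) hlam (hA.measurable_mark 1) ha hn)
  have hsum := (summable_geometric_of_norm_lt_one hγ).mul_left
    (gapLaplace P τ 0 (levyExponent P lam (a 1) s))
  simp only [← integral_pow_observed hA hlam.le hτ hindep hn.le, ← Complex.ofReal_pow] at hsum
  have : (fun n => ∫ ω, ((s ^ observed (markedProcess t a) τ n ω : ℝ) : ℂ) ∂P)
      = fun n => ((∫ ω, s ^ observed (markedProcess t a) τ n ω ∂P : ℝ) : ℂ) := by
    ext n; exact integral_ofReal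
  rw [this] at hsum
  exact Complex.summable_ofReal.1 hsum

theorem integrable_pow_observed (hA : IsMarkedPoisson P lam t a) (hτ : IsDelayedRenewal P τ)
    {s : ℝ} (hs0 : 0 ≤ s) (hs : s ≤ 1) (n : ℕ) :
    Integrable (fun ω => s ^ observed (markedProcess t a) τ n ω) P :=
  Integrable.of_bound ((measurable_of_countable fun k : ℕ => s ^ k).comp
    (measurable_observed hA.points.measurable hA.measurable_mark hτ.measurable
      n)).aestronglyMeasurable 1 (Filter.Eventually.of_forall fun ω => by
        rw [Real.norm_of_nonneg (by positivity)]; exact pow_le_one₀ hs0 hs)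

/-- On the event that no observation exceeds `M`, `(1/2)^{Aₙ} ≥ (1/2)^M` for every `n`, while
`E[(1/2)^{Aₙ}] → 0`. -/
theorem ae_exists_lt_observed (hA : IsMarkedPoisson P lam t a) (hlam : 0 < lam)
    (ha : ¬ ∀ᵐ ω ∂P, a 1 ω = 0) (hτ : IsDelayedRenewal P τ) (hΔ : ¬ ∀ᵐ ω ∂P, gap τ 1 ω = 0)
    (hindep : IndepFun (fun ω n => τ n ω) (fun ω s => markedProcess t a s ω) P) (M : ℕ) :
    ∀ᵐ ω ∂P, ∃ n, M < observed (markedProcess t a) τ n ω := by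
  have hobs := measurable_observed hA.points.measurable hA.measurable_mark hτ.measurable
  have htend := (summable_integral_pow_observed hA hlam ha hτ hΔ hindep
    (s := 1 / 2) (by norm_num) (by norm_num)).tendsto_atTop_zero
  set S : Set Ω := {ω | ∀ n, observed (markedProcess t a) τ n ω ≤ M} with hS
  have hSm : MeasurableSet S := by
    rw [hS, Set.ofPred_forall]
    exact MeasurableSet.iInter fun n => measurableSet_le (hobs n) measurable_const
  have hle : ∀ n, P.real S * (1 / 2 : ℝ) ^ M
      ≤ ∫ ω, (1 / 2 : ℝ) ^ observed (markedProcess t a) τ n ω ∂P := by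
    intro n
    have hi := integrable_pow_observed (P := P) hA hτ (s := 1 / 2) (by norm_num) (by norm_num) n
    have h1 : ∫ ω, S.indicator (fun _ => (1 / 2 : ℝ) ^ M) ω ∂P = P.real S * (1 / 2 : ℝ) ^ M := by
      rw [integral_indicator_const _ hSm, smul_eq_mul]
    rw [← h1]
    refine integral_mono ((integrable_const _).indicator hSm) hi fun ω => ?_
    by_cases hω : ω ∈ S
    · rw [Set.indicator_of_mem hω]
      exact pow_le_pow_of_le_one (by norm_num) (by norm_num) (hω n)
    · rw [Set.indicator_of_notMem hω]; positivity
  have h0 : P.real S * (1 / 2 : ℝ) ^ M ≤ 0 := ge_of_tendsto' htend hle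
  have hP : P.real S = 0 := by
    have : 0 < (1 / 2 : ℝ) ^ M := by positivity
    refine le_antisymm ?_ measureReal_nonneg
    by_contra hpos
    exact absurd h0 (not_le.2 (mul_pos (not_le.1 hpos) this))
  rw [measureReal_eq_zero_iff] at hP
  rw [ae_iff]
  refine (congrArg P ?_).trans hP
  ext ω
  simp [hS]

theorem laplaceTransform_preExitFunctional (hA : IsMarkedPoisson P lam t a)
    (hτ : IsDelayedRenewal P τ) (m : ℕ) {θ u v w x y : ℂ} (hθ : 0 < θ.re) (hu : ‖u‖ ≤ 1)
    (hv : ‖v‖ ≤ 1) (hy : ‖y‖ ≤ 1) (hw : 0 ≤ w.re) (hx : 0 ≤ x.re) :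
    laplaceTransform (preExitFunctional P (markedProcess t a) τ m u v w x y) θ
      = ∫ p : ℝ × Ω, Complex.exp (-θ * p.1) *
          preExitVariable (markedProcess t a) τ m u v w x y p.1 p.2
        ∂((volume.restrict (Set.Ici 0)).prod P) := by
  rw [integral_prod _ (integrable_exp_neg_mul_prod (P := P) hθ (measurable_preExitVariable
    hA.points.measurable hA.measurable_mark hτ.measurable m u v w x y)
    fun r _ ω => norm_preExitVariable_le_one hτ _ m hu hv hy hw hx r ω)]
  simp only [laplaceTransform, preExitFunctional, integral_const_mul]

/-- The pathwise identity is integrated against `e^{-θt}` on both sides: the sum over thresholds is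
dominated by `|s|^m`, the sum over indices by `2|s|^{Aₙ}`. -/
theorem hasSum_laplaceTransform (hA : IsMarkedPoisson P lam t a) (hlam : 0 < lam)
    (ha : ¬ ∀ᵐ ω ∂P, a 1 ω = 0) (hτ : IsDelayedRenewal P τ) (hΔ : ¬ ∀ᵐ ω ∂P, gap τ 1 ω = 0)
    (hindep : IndepFun (fun ω n => τ n ω) (fun ω s => markedProcess t a s ω) P)
    {θ u v w x y s : ℂ} (hθ : 0 < θ.re) (hu : ‖u‖ ≤ 1)
    (hv : ‖v‖ ≤ 1) (hy : ‖y‖ ≤ 1) (hw : 0 ≤ w.re) (hx : 0 ≤ x.re) (hs : ‖s‖ < 1)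
    (hκ : θ + lam * pgf P (a 1) (u * v * s) - lam * pgf P (a 1) (u * v * y * s) ≠ 0) :
    HasSum (fun m => s ^ m *
        laplaceTransform (preExitFunctional P (markedProcess t a) τ m u v w x y) θ)
      ((1 - s)⁻¹ * (coeffB1 (pgf P (a 1)) (jointTransform P (markedProcess t a) τ 1) lam θ u v x y s *
        (coeffB2 (jointTransform P (markedProcess t a) τ 0)
            (jointTransform P (markedProcess t a) τ 1) u v w s -
          coeffB3 (jointTransform P (markedProcess t a) τ 0)
            (jointTransform P (markedProcess t a) τ 1) θ u v w y s))) := by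
  set A := markedProcess t a with hAdef
  let Q : Measure (ℝ × Ω) := (volume.restrict (Set.Ici 0)).prod P
  let V : ℕ → ℝ × Ω → ℂ := fun m p => preExitVariable A τ m u v w x y p.1 p.2
  let D : ℕ → ℝ × Ω → ℂ := fun n p => observedTerm A τ n (u * v * s) y v w x p -
    observedTerm A τ n (u * v * s) y (v * s) w x p
  have huv : ‖u * v‖ ≤ 1 := by rw [norm_mul]; exact mul_le_one₀ hu (norm_nonneg _) hv
  have hzs : ‖u * v * s‖ ≤ ‖s‖ := by
    rw [norm_mul]; exact mul_le_of_le_one_left (norm_nonneg _) huv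
  have hz : ‖u * v * s‖ < 1 := hzs.trans_lt hs
  have hzy_eq : u * v * s * y = u * v * y * s := by ring
  have hzy : ‖u * v * y * s‖ < 1 := by
    rw [← hzy_eq, norm_mul]
    exact (mul_le_of_le_one_right (norm_nonneg _) hy).trans_lt hz
  have hvs : ‖v * s‖ ≤ 1 := by rw [norm_mul]; exact mul_le_one₀ hv (norm_nonneg _) hs.le
  have hVm : ∀ m, Measurable (V m) := fun m => measurable_preExitVariable
    hA.points.measurable hA.measurable_mark hτ.measurable m u v w x y
  have hVb : ∀ m p, ‖V m p‖ ≤ 1 := fun m p =>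
    norm_preExitVariable_le_one hτ A m hu hv hy hw hx p.1 p.2
  have hOm : ∀ n q, Measurable (observedTerm A τ n (u * v * s) y q w x) := fun n q =>
    measurable_observedTerm hA.points.measurable hA.measurable_mark hτ.measurable n _ y q w x
  have hOb : ∀ n q p, ‖q‖ ≤ 1 →
      ‖observedTerm A τ n (u * v * s) y q w x p‖ ≤ ‖s‖ ^ observed A τ n p.2 := fun n q p hq =>
    (norm_observedTerm_le hτ A n hy hq hw hx p).trans (pow_le_pow_left₀ (norm_nonneg _) hzs _)
  have hOi : ∀ n q, ‖q‖ ≤ 1 → Integrable (fun p : ℝ × Ω => Complex.exp (-θ * p.1) *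
      observedTerm A τ n (u * v * s) y q w x p) Q := fun n q hq =>
    integrable_exp_neg_mul_prod hθ (hOm n q) (C := 1) fun r _ ω =>
      (hOb n q (r, ω) hq).trans (pow_le_one₀ (norm_nonneg _) hs.le)
  have hE := (integrable_exp_neg_mul_Ici hθ).norm
  have hFi : ∀ m, Integrable (fun p : ℝ × Ω => Complex.exp (-θ * p.1) * (s ^ m * V m p)) Q :=
    fun m => integrable_exp_neg_mul_prod hθ ((hVm m).const_mul _) (C := 1) fun r _ ω => by
      rw [norm_mul, norm_pow]
      exact mul_le_one₀ (pow_le_one₀ (norm_nonneg _) hs.le) (norm_nonneg _) (hVb m _)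
  have hF := hasSum_integral_of_summable_integral_norm hFi (by
    refine Summable.of_nonneg_of_le (fun m => integral_nonneg fun p => norm_nonneg _)
      (fun m => ?_) ((summable_geometric_of_lt_one (norm_nonneg s) hs).mul_left
        (∫ p : ℝ × Ω, ‖Complex.exp (-θ * p.1)‖ ∂Q))
    rw [← integral_mul_const]
    refine integral_mono (hFi m).norm ((hE.comp_fst P).mul_const _) fun p => ?_
    simp only [norm_mul, norm_pow]
    exact mul_le_mul_of_nonneg_left (mul_le_of_le_one_right (by positivity) (hVb m p))
      (norm_nonneg _))
  have hDi : ∀ n, Integrable (fun p : ℝ × Ω => Complex.exp (-θ * p.1) * D n p) Q := fun n => by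
    simp only [D, mul_sub]
    exact (hOi n v hv).sub (hOi n (v * s) hvs)
  have hG := hasSum_integral_of_summable_integral_norm hDi (by
    refine Summable.of_nonneg_of_le (fun m => integral_nonneg fun p => norm_nonneg _)
      (fun n => ?_) ((summable_integral_pow_observed hA hlam ha hτ hΔ hindep (norm_nonneg s)
        hs).mul_left ((∫ r : ℝ in Set.Ici 0, ‖Complex.exp (-θ * r)‖) * 2))
    rw [mul_assoc, ← integral_const_mul, ← integral_prod_mul]
    refine integral_mono (hDi n).norm (hE.mul_prod
      ((integrable_pow_observed hA hτ (norm_nonneg s) hs.le n).const_mul 2)) fun p => ?_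
    simp only [norm_mul, D]
    refine mul_le_mul_of_nonneg_left ((norm_sub_le _ _).trans ?_) (norm_nonneg _)
    linarith [hOb n v p hv, hOb n (v * s) p hvs])
  have hae : ∀ᵐ p ∂Q, ∑' n, Complex.exp (-θ * p.1) * D n p
      = (1 - s) * ∑' m, Complex.exp (-θ * p.1) * (s ^ m * V m p) := by
    have h1 : ∀ᵐ r ∂(volume.restrict (Set.Ici (0 : ℝ))), 0 ≤ r := ae_restrict_mem measurableSet_Ici
    have h2 := ae_all_iff.2 fun m => ae_exists_lt_observed hA hlam ha hτ hΔ hindep m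
    filter_upwards [Measure.quasiMeasurePreserving_fst.ae h1,
      Measure.quasiMeasurePreserving_snd.ae h2,
      Measure.quasiMeasurePreserving_snd.ae hA.points.ae_finite] with p hp1 hp2 hp3
    rw [tsum_mul_left, tsum_mul_left,
      (hasSum_observedTerm_sub hτ hp3 hp2 hu hv hy hw hx hs hp1).tsum_eq]
    ring
  rw [integral_congr_ae hae, integral_const_mul] at hG
  have hDint : ∀ n, ∫ p : ℝ × Ω, Complex.exp (-θ * p.1) * D n p ∂Q
      = (gapLaplace P τ 1 (x + levyExponent P lam (a 1) v) -
          gapLaplace P τ 1 (x + levyExponent P lam (a 1) (v * s))) /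
          (θ + lam * pgf P (a 1) (u * v * s) - lam * pgf P (a 1) (u * v * y * s)) *
        (gapLaplace P τ 0 (w + levyExponent P lam (a 1) (u * v * s)) *
            gapLaplace P τ 1 (w + levyExponent P lam (a 1) (u * v * s)) ^ n -
          gapLaplace P τ 0 (θ + w + levyExponent P lam (a 1) (u * v * y * s)) *
            gapLaplace P τ 1 (θ + w + levyExponent P lam (a 1) (u * v * y * s)) ^ n) := by
    intro n
    simp only [D, mul_sub]
    rw [integral_sub (hOi n v hv) (hOi n (v * s) hvs),
      integral_exp_mul_observedTerm hA hlam.le hτ hindep n hθ hz.le hy hv hw hx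
        (by rwa [hzy_eq]),
      integral_exp_mul_observedTerm hA hlam.le hτ hindep n hθ hz.le hy hvs hw hx
        (by rwa [hzy_eq]), hzy_eq]
    ring
  -- Since `Re w` may be 0, convergence for `B₂` needs strict positivity of `Re β(uvs)`; for `B₃`,
  -- `Re θ > 0` suffices.
  have hβ₂ := levyExponent_re_pos (P := P) hlam (hA.measurable_mark 1) ha hz
  have hβ₃ := levyExponent_re_nonneg (P := P) hlam.le (a 1) hzy.le
  have hγ₂ := norm_gapLaplace_one_lt_one hτ hΔ (c := w + levyExponent P lam (a 1) (u * v * s))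
    (by rw [Complex.add_re]; linarith)
  have hγ₃ := norm_gapLaplace_one_lt_one hτ hΔ
    (c := θ + w + levyExponent P lam (a 1) (u * v * y * s))
    (by rw [Complex.add_re, Complex.add_re]; linarith)
  have hgeo := (((hasSum_geometric_of_norm_lt_one hγ₂).mul_left
      (gapLaplace P τ 0 (w + levyExponent P lam (a 1) (u * v * s)))).sub
    ((hasSum_geometric_of_norm_lt_one hγ₃).mul_left
      (gapLaplace P τ 0 (θ + w + levyExponent P lam (a 1) (u * v * y * s))))).mul_left
    ((gapLaplace P τ 1 (x + levyExponent P lam (a 1) v) -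
      gapLaplace P τ 1 (x + levyExponent P lam (a 1) (v * s))) /
      (θ + lam * pgf P (a 1) (u * v * s) - lam * pgf P (a 1) (u * v * y * s)))
  simp only [hDint] at hG
  have huniq := hG.unique hgeo
  have hθw : 0 ≤ (θ + w).re := by simpa using add_nonneg hθ.le hw
  rw [coeffB1, coeffB2, coeffB3, jointTransform_one_eq hA hlam.le hτ hindep hv hx,
    jointTransform_one_eq hA hlam.le hτ hindep hvs hx,
    jointTransform_one_eq hA hlam.le hτ hindep hz.le hw,
    jointTransform_zero_eq hA hlam.le hτ hindep hz.le hw,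
    jointTransform_one_eq hA hlam.le hτ hindep hzy.le hθw,
    jointTransform_zero_eq hA hlam.le hτ hindep hzy.le hθw, div_eq_mul_inv (gapLaplace P τ 0 _),
    div_eq_mul_inv (gapLaplace P τ 0 _), ← huniq, inv_mul_cancel_left₀]
  · have hterm : (fun m => s ^ m * laplaceTransform (preExitFunctional P A τ m u v w x y) θ)
        = fun m => ∫ p : ℝ × Ω, Complex.exp (-θ * p.1) * (s ^ m * V m p) ∂Q := by
      ext m
      rw [laplaceTransform_preExitFunctional hA hτ m hθ hu hv hy hw hx, ← integral_const_mul]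
      congr 1
      ext p
      simp only [V]
      ring
    rw [hterm]
    exact hF
  · intro h
    rw [sub_eq_zero] at h
    rw [← h] at hs
    simp at hs

end Laplace

theorem mainTheorem1 {Ω : Type*} [MeasurableSpace Ω] (P : Measure Ω) [IsProbabilityMeasure P]
    (lam : ℝ) (hlam : 0 < lam)
    (t : ℕ → Ω → ℝ) (a : ℕ → Ω → ℕ) (hA : IsMarkedPoisson P lam t a)
    (ha : ¬ ∀ᵐ ω ∂P, a 1 ω = 0)
    (τ : ℕ → Ω → ℝ) (hτ : IsDelayedRenewal P τ)
    (hΔ : ¬ ∀ᵐ ω ∂P, gap τ 1 ω = 0)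
    (hindep : IndepFun (fun ω n => τ n ω) (fun ω s => markedProcess t a s ω) P)
    (M : ℕ) (θ u v w x y : ℂ) (hθ : 0 < θ.re)
    (hu : ‖u‖ ≤ 1) (hv : ‖v‖ ≤ 1) (hy : ‖y‖ ≤ 1) (hw : 0 ≤ w.re) (hx : 0 ≤ x.re) :
    let A : ℝ → Ω → ℕ := markedProcess t a
    let g : ℂ → ℂ := pgf P (a 1)
    let γ₀ : ℂ → ℂ → ℂ := jointTransform P A τ 0
    let γ : ℂ → ℂ → ℂ := jointTransform P A τ 1
    let G₁ : ℝ → ℂ := preExitFunctional P A τ M u v w x y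
    let Φ : ℂ → ℂ := fun s =>
      coeffB1 g γ lam θ u v x y s * (coeffB2 γ₀ γ u v w s - coeffB3 γ₀ γ θ u v w y s)
    (∀ᵐ ω ∂P, ∃ n, M < observed A τ n ω) ∧
    (∀ r : ℝ, 0 ≤ r → Integrable (preExitVariable A τ M u v w x y r) P) ∧
    IntegrableOn (fun r : ℝ => Complex.exp (-θ * (r : ℂ)) * G₁ r) (Set.Ici 0) ∧
    AnalyticAt ℂ Φ 0 ∧
    laplaceTransform G₁ θ = invD M Φ := by
  intro A g γ₀ γ G₁ Φ
  have hm := measurable_preExitVariable hA.points.measurable hA.measurable_mark hτ.measurable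
    M u v w x y
  have hb := norm_preExitVariable_le_one hτ A M hu hv hy hw hx
  have hev : ∀ᶠ s in nhds (0 : ℂ), HasSum (fun m => s ^ m *
      laplaceTransform (preExitFunctional P A τ m u v w x y) θ) ((1 - s)⁻¹ * Φ s) := by
    -- The second bound on `|s|` gives `λ|g(uvs) - g(uvys)| ≤ 2λ|s| < Re θ`, so the denominator of
    -- `B₁` is nonzero.
    have hε : 0 < min 1 (θ.re / (2 * lam)) := lt_min one_pos (by positivity)
    filter_upwards [Metric.ball_mem_nhds (0 : ℂ) hε] with s hs
    rw [mem_ball_zero_iff, lt_min_iff, lt_div_iff₀ (by positivity)] at hs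
    have hle : ∀ z : ℂ, ‖z‖ ≤ 1 → ‖z * s‖ ≤ ‖s‖ := fun z hz => by
      rw [norm_mul]; exact mul_le_of_le_one_left (norm_nonneg _) hz
    have huv : ‖u * v‖ ≤ 1 := by rw [norm_mul]; exact mul_le_one₀ hu (norm_nonneg _) hv
    have huvy : ‖u * v * y‖ ≤ 1 := by rw [norm_mul]; exact mul_le_one₀ huv (norm_nonneg _) hy
    refine hasSum_laplaceTransform hA hlam ha hτ hΔ hindep hθ hu hv hy hw hx hs.1 fun h0 => ?_
    have h1 := norm_pgf_sub_pgf_zero_le (P := P) (hA.measurable_mark 1)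
      ((hle _ huv).trans hs.1.le)
    have h2 := norm_pgf_sub_pgf_zero_le (P := P) (hA.measurable_mark 1)
      ((hle _ huvy).trans hs.1.le)
    have h3 : θ = lam * ((g (u * v * y * s) - g 0) - (g (u * v * s) - g 0)) := by
      linear_combination h0
    have h4 : ‖θ‖ ≤ lam * (‖s‖ + ‖s‖) := by
      rw [h3, norm_mul, Complex.norm_of_nonneg hlam.le]
      refine mul_le_mul_of_nonneg_left ((norm_sub_le _ _).trans ?_) hlam.le
      exact add_le_add (h2.trans (hle _ huvy)) (h1.trans (hle _ huv))
    have h5 := Complex.re_le_norm θ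
    nlinarith [hs.2]
  obtain ⟨han, hinv⟩ := analyticAt_and_invD_eq_of_hasSum hev M
  refine ⟨ae_exists_lt_observed hA hlam ha hτ hΔ hindep M, fun r _ => ?_, ?_, han, hinv.symm⟩
  · exact integrable_of_norm_le_one (hm.comp (measurable_const.prodMk measurable_id)) (hb r)
  · have := (integrable_exp_neg_mul_prod (P := P) hθ hm fun r _ ω => hb r ω).integral_prod_left
    simp only [integral_const_mul] at this
    exact this
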